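/- Let $F$ be the free group of finite rank $k$ on a fixed free generating set, let $X$ be the rose with $k$ petals, and let $L>0$ be divisible by $4$. Let $S'(L)$ be the finite set of (untagged) loops of length $L$, i.e. cyclically reduced cyclic words of length $L$ in the generators and their inverses. Let $W'(L)=\mathbb{Q}[S'(L)]$, let $h:W'(L)\to H_1(F;\mathbb{Q})=\mathbb{Q}^k$ be the linear map sending a loop to its homology class, let $V'(L)=\ker h$, and let $\mathbf{1}'\in V'(L)$ be the vector all of whose coordinates are $1$. A fatgraph over $X$ is a finite graph $Y$ with a cyclic order on the edges at each vertex and a locally injective simplicial map $Y\to X$; its fattening $S(Y)$ is an oriented surface whose boundary components are read as cyclic words. A vector $w\in W'(L)$ with nonnegative integer coordinates *bounds* $Y$ if the boundary components of $S(Y)$ are loops in $S'(L)$ and each $s\in S'(L)$ occurs among them exactly $w_s$ times. The fatgraph $Y$, with all boundary components in $S'(L)$, is *thin* if it is trivalent (components that are circles without trivalent vertices are allowed) and distinct trivalent vertices are at distance at least $L/4$ from each other. A *good pair of pants* is a trivalent fatgraph $Y$ with $S(Y)$ a pair of pants, all edges of length exactly $L/2$, and boundary components in $S'(L)$. A *good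 annulus* is a fatgraph $Y$ with $S(Y)$ an annulus and both boundary components in $S'(L)$. Let $C'(L)\subseteq V'(L)$ be the cone of vectors that projectively bound a thin fatgraph, i.e. that have a positive rational multiple bounding a thin fatgraph. Then: 1. For every vector $v\in V'(L)$ with integer coordinates there is $n\in\mathbb{N}$ such that $(L/2)\,v+n\mathbf{1}'$ bounds a finite disjoint union of good pairs of pants and good annuli, and this union is a thin fatgraph. 2. $C'(L)$ is full-dimensional, i.e. it spans $V'(L)$, and it contains an open projective neighborhood of $\mathbf{1}'$: there is an open subset $U$ of $V'(L)$, invariant under multiplication by positive rationals, with $\mathbf{1}'\in U\subseteq C'(L)$. -/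

import Mathlib

/-! Loops in a rose, vectors of loops, and fatgraphs over a rose.

The rose with `k` petals has the free group of rank `k` as its fundamental group. A signed letter
`(i, b) : Fin k × Bool` is the `i`-th generator (`b = true`) or its inverse (`b = false`), the same
convention as for `FreeGroup (Fin k)`. -/

noncomputable section

namespace ThinFatgraph

/-! ### Loops and vectors of loops -/

/-- A cyclic word is a loop of length `L` if it has `L` letters and is cyclically reduced: no letter
is followed, cyclically, by its inverse. -/
def IsLoop {k : ℕ} (L : ℕ) (c : Cycle (Fin k × Bool)) : Prop :=
  c.length = L ∧ c.Chain fun a b => a.1 = b.1 → a.2 = b.2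

/-- The set `S'(L)` of (untagged) loops of length `L`: cyclically reduced cyclic words of length
`L` in the free group of rank `k`. -/
def Loop (k L : ℕ) : Type := {c : Cycle (Fin k × Bool) // IsLoop L c}

instance (k L : ℕ) : Finite (Loop k L) := by
  have : Function.Surjective
      (fun w : List.Vector (Fin k × Bool) L =>
        (⟨(w.1 : Cycle (Fin k × Bool)), by simp⟩ : {c : Cycle (Fin k × Bool) // c.length = L})) := by
    rintro ⟨c, hc⟩
    induction c using Quotient.inductionOn' with
    | h l => exact ⟨⟨l, by simpa using hc⟩, rfl⟩
  have hfin := Finite.of_surjective _ this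
  exact Finite.of_injective
    (fun s : Loop k L => (⟨s.1, s.2.1⟩ : {c : Cycle (Fin k × Bool) // c.length = L}))
    (fun s t h => Subtype.ext (congrArg (fun x => x.1) h))

instance (k L : ℕ) : Fintype (Loop k L) := Fintype.ofFinite _

/-- The class of a cyclic word in `H₁` of the rose: its vector of exponent sums. -/
def homology {k : ℕ} (c : Cycle (Fin k × Bool)) : Fin k → ℚ := fun i =>
  (c.toMultiset.count (i, true) : ℚ) - (c.toMultiset.count (i, false) : ℚ)

/-- The linear map `h` from `W'(L) = ℚ[S'(L)]` (functions on the finite set `S'(L)`) to `H₁`. -/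
def homologyMap (k L : ℕ) : (Loop k L → ℚ) →ₗ[ℚ] (Fin k → ℚ) :=
  Fintype.linearCombination ℚ fun s : Loop k L => homology s.1

/-- The space `V'(L) = ker h` of homologically trivial vectors. -/
def homTrivial (k L : ℕ) : Submodule ℚ (Loop k L → ℚ) := LinearMap.ker (homologyMap k L)

/-- The inverse of a signed letter. -/
def invLetter {k : ℕ} (a : Fin k × Bool) : Fin k × Bool := (a.1, !a.2)

/-- The inverse of a loop. -/
def Loop.inv {k L : ℕ} (s : Loop k L) : Loop k L :=
  ⟨(s.1.map invLetter).reverse, by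
    obtain ⟨c, hc, hr⟩ := s
    constructor
    · change ((c.map invLetter).reverse).length = L
      rw [← hc]
      clear hc hr
      induction c using Quotient.inductionOn' with
      | h l =>
        change ((l.map invLetter).reverse).length = l.length
        simp
    · simp only
      induction c using Quotient.inductionOn' with
      | h l =>
        rcases l with - | ⟨a, l⟩
        · trivial
        · have h1 : Cycle.Chain (fun a b : Fin k × Bool => a.1 = b.1 → a.2 = b.2)
              ((a :: l : List (Fin k × Bool)) : Cycle (Fin k × Bool)) := hr
          rw [Cycle.chain_coe_cons] at h1
          change Cycle.Chain _ ((((a :: l).map invLetter).reverse : List (Fin k × Bool)) : Cycle (Fin k × Bool))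
          rw [List.map_cons, List.reverse_cons, ← Cycle.coe_cons_eq_coe_append,
            Cycle.chain_coe_cons]
          have h2 := (List.isChain_map (R := fun a b : Fin k × Bool => b.1 = a.1 → b.2 = a.2)
            (invLetter (k := k)) (l := a :: (l ++ [a]))).2 (h1.imp (by
              intro x y hxy h; simp only [invLetter] at h ⊢; rw [hxy h.symm]))
          have h3 := List.isChain_reverse.2 h2
          simpa using h3⟩

theorem Loop.inv_inv {k L : ℕ} (s : Loop k L) : s.inv.inv = s := by
  obtain ⟨c, hc⟩ := s
  apply Subtype.ext
  change (((c.map invLetter).reverse).map invLetter).reverse = c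
  induction c using Quotient.inductionOn' with
  | h l =>
    change ((((l.map invLetter).reverse.map invLetter).reverse : List (Fin k × Bool)) :
      Cycle (Fin k × Bool)) = (l : Cycle (Fin k × Bool))
    congr 1
    simp [invLetter, Function.comp_def]

theorem homology_inv {k L : ℕ} (s : Loop k L) : homology s.inv.1 = - homology s.1 := by
  obtain ⟨c, hc⟩ := s
  change homology ((c.map invLetter).reverse) = - homology c
  clear hc
  induction c using Quotient.inductionOn' with
  | h l =>
    funext i
    have hinj : Function.Injective (invLetter (k := k)) := by
      rintro ⟨a, b⟩ ⟨a', b'⟩ h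
      simpa [invLetter] using h
    have key : ∀ b : Bool, Multiset.count (i, b)
        (((l.map invLetter).reverse : List (Fin k × Bool)) : Multiset (Fin k × Bool))
        = Multiset.count (i, !b) (l : Multiset (Fin k × Bool)) := by
      intro b
      have := Multiset.count_map_eq_count' invLetter (l : Multiset (Fin k × Bool)) hinj (i, !b)
      rw [Multiset.coe_reverse, ← Multiset.map_coe]
      simpa only [invLetter, Bool.not_not] using this
    change ((Multiset.count (i, true)
        (((l.map invLetter).reverse : List (Fin k × Bool)) : Multiset (Fin k × Bool)) : ℚ)
      - (Multiset.count (i, false)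
        (((l.map invLetter).reverse : List (Fin k × Bool)) : Multiset (Fin k × Bool)) : ℚ))
      = - ((Multiset.count (i, true) (l : Multiset (Fin k × Bool)) : ℚ)
        - (Multiset.count (i, false) (l : Multiset (Fin k × Bool)) : ℚ))
    rw [key, key, neg_sub, Bool.not_true, Bool.not_false]

/-- The uniform vector `1'`, all of whose coordinates are `1`. -/
def uniform (k L : ℕ) : homTrivial k L :=
  ⟨fun _ => 1, by
    have hsum : (∑ s : Loop k L, homology s.1) = - ∑ s : Loop k L, homology s.1 := by
      rw [← Finset.sum_neg_distrib]
      refine Fintype.sum_bijective (Loop.inv (k := k) (L := L))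
        (Function.Involutive.bijective Loop.inv_inv) _ _ ?_
      intro s
      rw [homology_inv, neg_neg]
    have h0 : (∑ s : Loop k L, homology s.1) = 0 := self_eq_neg.1 hsum
    change homologyMap k L (fun _ => 1) = 0
    simpa [homologyMap, Fintype.linearCombination_apply] using h0⟩

/-! ### Fatgraphs -/

/-- A finite folded fatgraph with a simplicial map to the rose with `k` petals.

A dart is an oriented edge, `src` is its initial vertex, `rev` reverses the orientation, and `next`
is the cyclic order on the darts that leave a vertex. Each dart runs over one petal of the rose,
given by `label`, so an edge of length `m` of a fatgraph is subdivided here into `m` edges by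
vertices of valence two. `folded` says that the map to the rose is locally injective. No component
is a single point. -/
structure Fatgraph (k : ℕ) where
  /-- the vertices -/
  Vertex : Type
  /-- the oriented edges -/
  Dart : Type
  finVertex : Finite Vertex
  finDart : Finite Dart
  /-- the initial vertex -/
  src : Dart → Vertex
  /-- reversal of orientation -/
  rev : Equiv.Perm Dart
  /-- the cyclic order around the vertices -/
  next : Equiv.Perm Dart
  /-- the petal of the rose, with direction -/
  label : Dart → Fin k × Bool
  rev_rev : ∀ d, rev (rev d) = d
  rev_ne : ∀ d, rev d ≠ d
  src_eq_iff : ∀ d e, src d = src e ↔ next.SameCycle d e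
  src_surjective : Function.Surjective src
  label_rev : ∀ d, label (rev d) = invLetter (label d)
  folded : ∀ d e, src d = src e → label d = label e → d = e

namespace Fatgraph

variable {k : ℕ}

/-- The successor of a dart along the boundary of the fattening `S(Y)`: go along the dart, then
leave by the next dart in the cyclic order at its terminal vertex. -/
def face (Y : Fatgraph k) : Equiv.Perm Y.Dart := Y.next * Y.rev

/-- The components of the boundary of the fattening: the cycles of `face`. -/
def Boundary (Y : Fatgraph k) : Type := Quotient (Equiv.Perm.SameCycle.setoid Y.face)

/-- The cyclic word read along a boundary component. -/
def boundaryWord (Y : Fatgraph k) : Y.Boundary → Cycle (Fin k × Bool) :=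
  Quotient.lift (fun d => (Function.periodicOrbit Y.face d).map Y.label) (by
    intro d e hde
    have := Y.finDart
    obtain ⟨n, hn⟩ := Equiv.Perm.SameCycle.exists_nat_pow_eq (show Y.face.SameCycle d e from hde)
    have he : e = Y.face^[n] d := by rw [← hn, Equiv.Perm.iterate_eq_pow]
    have hd : d ∈ Function.periodicPts Y.face :=
      Function.Injective.mem_periodicPts Y.face.injective d
    simp only [he, Function.periodicOrbit_apply_iterate_eq hd])

/-- The number of darts that leave a vertex. -/
def valence (Y : Fatgraph k) (v : Y.Vertex) : ℕ := Nat.card {d : Y.Dart // Y.src d = v}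

/-- Adjacency of vertices. -/
def graph (Y : Fatgraph k) : SimpleGraph Y.Vertex :=
  SimpleGraph.fromRel fun u v => ∃ d, Y.src d = u ∧ Y.src (Y.rev d) = v

/-- Number of vertices minus number of edges; this is the Euler characteristic of `S(Y)`. -/
def eulerChar (Y : Fatgraph k) : ℤ := (Nat.card Y.Vertex : ℤ) - (Nat.card Y.Dart : ℤ) / 2

/-- Every vertex is trivalent, apart from the vertices of valence two that subdivide the edges
(circles without trivalent vertices are allowed). -/
def IsTrivalent (Y : Fatgraph k) : Prop := ∀ v, Y.valence v = 2 ∨ Y.valence v = 3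

/-- Every boundary component is a loop of length `L`. -/
def HasBoundaryIn (Y : Fatgraph k) (L : ℕ) : Prop := ∀ b, IsLoop L (Y.boundaryWord b)

/-- A fatgraph whose boundary components are loops of length `L` is thin if it is trivalent and
its trivalent vertices have pairwise distance at least `L / 4`. -/
def IsThin (Y : Fatgraph k) (L : ℕ) : Prop :=
  Y.HasBoundaryIn L ∧ Y.IsTrivalent ∧
    ∀ u v, Y.valence u = 3 → Y.valence v = 3 → u ≠ v → (L : ℕ∞) ≤ 4 * Y.graph.edist u v

/-- The boundary of `Y` is the collection of loops represented by the vector `w`: every component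
is a loop of length `L`, and each loop `s` occurs exactly `w s` times. -/
def Bounds (Y : Fatgraph k) {L : ℕ} (w : Loop k L → ℚ) : Prop :=
  Y.HasBoundaryIn L ∧ ∀ s : Loop k L, (Nat.card {b // Y.boundaryWord b = s.1} : ℚ) = w s

/-- Every edge between trivalent vertices has length exactly `m`. At a vertex of valence two,
`face` continues along the same edge. -/
def EdgesHaveLength (Y : Fatgraph k) (m : ℕ) : Prop :=
  ∀ d, Y.valence (Y.src d) = 3 →
    Y.valence (Y.src ((Y.face ^ m) d)) = 3 ∧
    ∀ j, 0 < j → j < m → Y.valence (Y.src ((Y.face ^ j) d)) = 2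

/-- A good pair of pants: a trivalent fatgraph whose fattening is a pair of pants (connected,
Euler characteristic `-1`, three boundary components), with all edges of length exactly `L / 2`
and whose boundary components are loops of length `L`. -/
def IsGoodPants (Y : Fatgraph k) (L : ℕ) : Prop :=
  Y.graph.Connected ∧ Y.eulerChar = -1 ∧ Nat.card Y.Boundary = 3 ∧
    Y.IsTrivalent ∧ Y.EdgesHaveLength (L / 2) ∧ Y.HasBoundaryIn L

/-- A good annulus: a fatgraph whose fattening is an annulus (connected, Euler characteristic `0`,
two boundary components) and whose boundary components are loops of length `L`. -/
def IsGoodAnnulus (Y : Fatgraph k) (L : ℕ) : Prop :=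
  Y.graph.Connected ∧ Y.eulerChar = 0 ∧ Nat.card Y.Boundary = 2 ∧ Y.HasBoundaryIn L

/-- The disjoint union of finitely many fatgraphs. -/
def disjointUnion {m : ℕ} (P : Fin m → Fatgraph k) : Fatgraph k where
  Vertex := Σ i, (P i).Vertex
  Dart := Σ i, (P i).Dart
  finVertex := by
    have := fun i => (P i).finVertex
    infer_instance
  finDart := by
    have := fun i => (P i).finDart
    infer_instance
  src := fun d => ⟨d.1, (P d.1).src d.2⟩
  rev := Equiv.Perm.sigmaCongrRight fun i => (P i).rev
  next := Equiv.Perm.sigmaCongrRight fun i => (P i).next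
  label := fun d => (P d.1).label d.2
  rev_rev := by
    rintro ⟨i, d⟩
    simp [(P i).rev_rev]
  rev_ne := by
    rintro ⟨i, d⟩ h
    exact (P i).rev_ne d (by simpa using h)
  src_eq_iff := by
    have hz : ∀ (n : ℤ) (i : Fin m) (d : (P i).Dart),
        ((Equiv.Perm.sigmaCongrRight fun i => (P i).next) ^ n) ⟨i, d⟩
          = ⟨i, ((P i).next ^ n) d⟩ := by
      intro n i d
      have h := map_zpow (Equiv.Perm.sigmaCongrRightHom fun i => (P i).Dart)
        (fun i => (P i).next) n
      have h' := congrArg (fun e : Equiv.Perm (Σ i, (P i).Dart) => e ⟨i, d⟩) h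
      simpa using h'.symm
    rintro ⟨i, d⟩ ⟨j, e⟩
    constructor
    · intro h
      obtain rfl : i = j := congrArg Sigma.fst h
      have h' : (P i).src d = (P i).src e := by simpa using h
      obtain ⟨n, hn⟩ := ((P i).src_eq_iff d e).1 h'
      exact ⟨n, by rw [hz, hn]⟩
    · rintro ⟨n, hn⟩
      rw [hz] at hn
      obtain rfl : i = j := congrArg Sigma.fst hn
      have h' : ((P i).next ^ n) d = e := by simpa using hn
      have := ((P i).src_eq_iff d e).2 ⟨n, h'⟩
      simp [this]
  src_surjective := by
    rintro ⟨i, v⟩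
    obtain ⟨d, rfl⟩ := (P i).src_surjective v
    exact ⟨⟨i, d⟩, rfl⟩
  label_rev := by
    rintro ⟨i, d⟩
    exact (P i).label_rev d
  folded := by
    rintro ⟨i, d⟩ ⟨j, e⟩ h hl
    obtain rfl : i = j := congrArg Sigma.fst h
    have h' : (P i).src d = (P i).src e := by simpa using h
    rw [(P i).folded d e h' hl]

end Fatgraph

/-- The cone `C'(L)` of the homologically trivial vectors that projectively bound a thin fatgraph:
some positive multiple is integral and represents the boundary of a thin fatgraph. -/
def thinCone (k L : ℕ) : Set (homTrivial k L) :=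
  {v | ∃ c : ℚ, 0 < c ∧ ∃ Y : Fatgraph k, Y.IsThin L ∧ Y.Bounds (c • (v : Loop k L → ℚ))}

end ThinFatgraph

end

noncomputable section

namespace ThinFatgraph

/-! Write L = 2(n+1). Three reduced words a, b, c of length L/2 with pairwise different first
letters and pairwise different last letters are the edges of a folded theta graph. Its fattening is
a pair of pants with boundary ab⁻¹, bc⁻¹, ca⁻¹, and its two trivalent vertices are at distance L/2.
A loop s together with s⁻¹ bounds an annulus. The heart of the proof is that these boundaries
generate all integral homologically trivial vectors as a group.

For this, let φ be a function on loops, with values in any abelian group, that kills pants and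
annuli (`IsLoopCocycle`). It must be shown that φ kills homologically trivial vectors
(`IsLoopCocycle.sum_eq_zero`); a quotient group then gives the generation statement
(`mem_stablyGood`). Place a word on the chessboard square given by its first letter and the inverse
of its last letter. Then φ(ab⁻¹) is a cocycle defined only on pairs that differ in row and column.
With at least four letters it has a potential: φ(ab⁻¹) = g(a) - g(b) (`exists_potential`). Comparing
different cuts of one loop into halves shows that g is a sum of weights of letters plus a constant
(`exists_letter_potential`). Hence φ only sees letter counts, and homological triviality finishes.
Ranks zero and one are done by hand.

Negative coefficients are absorbed by the uniform vector: the sum of s + s⁻¹ over all loops s is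
2·1', so the negative of a generator becomes good after adding a multiple of 1'. Nonnegative sums
are realized by disjoint unions. Applying this to finitely many vectors that span V', and to their
negatives, gives the open neighborhood of 1'. -/

theorem exists_ne_three {α : Type*} [Fintype α] (hα : 4 ≤ Fintype.card α) (p q r : α) :
    ∃ x, x ≠ p ∧ x ≠ q ∧ x ≠ r := by
  classical
  have h : ({p, q, r} : Finset α).card < Fintype.card α := Finset.card_le_three.trans_lt hα
  obtain ⟨x, hx⟩ := Finset.exists_mem_notMem_of_card_lt_card (s := {p, q, r}) (t := Finset.univ) h
  exact ⟨x, by simpa using hx.2⟩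

/-- Two different elements that avoid `r` and `p`, and one forbidden value each. -/
theorem exists_pair_ne {α : Type*} [Fintype α] (hα : 4 ≤ Fintype.card α) (r p : α) {q q' : α}
    (hq : q ≠ q') :
    ∃ x y, x ≠ y ∧ x ≠ r ∧ x ≠ p ∧ y ≠ r ∧ y ≠ p ∧ x ≠ q' ∧ y ≠ q := by
  obtain ⟨x, hxr, hxp, hxq⟩ := exists_ne_three hα r p q'
  obtain ⟨y, hyr, hyp, hyx⟩ := exists_ne_three hα r p x
  by_cases h : y = q
  · exact ⟨y, x, hyx, hyr, hyp, hxr, hxp, h ▸ hq, fun h' => hyx (h.trans h'.symm)⟩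
  · exact ⟨x, y, hyx.symm, hxr, hxp, hyr, hyp, hxq, h⟩

/-! ### Potentials of partial cocycles on a chessboard -/

section Potential

variable {α W A : Type*} [AddCommGroup A]

/-- A cocycle on the pairs of elements that differ both in their row and in their column. -/
structure IsPartialCocycle (row col : W → α) (f : W → W → A) : Prop where
  antisymm : ∀ a b, row a ≠ row b → col a ≠ col b → f a b = -f b a
  cocycle : ∀ a b c, row a ≠ row b → col a ≠ col b → row b ≠ row c → col b ≠ col c →
    row a ≠ row c → col a ≠ col c → f a b + f b c = f a c

namespace IsPartialCocycle

variable {row col : W → α} {f : W → W → A}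

theorem swap (hf : IsPartialCocycle row col f) : IsPartialCocycle col row f :=
  ⟨fun a b h1 h2 => hf.antisymm a b h2 h1,
    fun a b c h1 h2 h3 h4 h5 h6 => hf.cocycle a b c h2 h1 h4 h3 h6 h5⟩

/-- Both sides equal `f a c + f c c' + f c' b`: the intermediate point may move to any other one
that differs from it in row and column. -/
theorem step (hf : IsPartialCocycle row col f) {a b c c' : W}
    (h1 : row a ≠ row c) (h2 : col a ≠ col c) (h3 : row c ≠ row b) (h4 : col c ≠ col b)
    (h1' : row a ≠ row c') (h2' : col a ≠ col c') (h3' : row c' ≠ row b) (h4' : col c' ≠ col b)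
    (h5 : row c ≠ row c') (h6 : col c ≠ col c') :
    f a c + f c b = f a c' + f c' b := by
  rw [← hf.cocycle a c c' h1 h2 h5 h6 h1' h2', ← hf.cocycle c c' b h5 h6 h3' h4' h3 h4, add_assoc]

/-- By `step`, it suffices to join `c` to `c'` by a path of admissible intermediate points,
consecutive ones differing in row and column. Only one row and at most two columns are forbidden,
which leaves room for such a path. -/
theorem eq_of_row_eq [Fintype α] (hf : IsPartialCocycle row col f) (hα : 4 ≤ Fintype.card α)
    (hW : ∀ r s, r ≠ s → ∃ w, row w = r ∧ col w = s) {a b c c' : W} (hab : row a = row b)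
    (h1 : row a ≠ row c) (h2 : col a ≠ col c) (h4 : col c ≠ col b)
    (h1' : row a ≠ row c') (h2' : col a ≠ col c') (h4' : col c' ≠ col b) :
    f a c + f c b = f a c' + f c' b := by
  have key : ∀ c c' : W, row c = row c' → col c ≠ col c' → row a ≠ row c →
      col a ≠ col c → col c ≠ col b → col a ≠ col c' → col c' ≠ col b →
      f a c + f c b = f a c' + f c' b := by
    intro c c' hr hc h1 h2 h4 h2' h4'
    -- The path `c`, `t`, `u`, `c'` alternates between the columns of `c` and `c'`, with `t` and `u`
    -- in two new rows. The bounds `hx`, `hy` keep `t` and `u` off the diagonal, where squares may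
    -- be empty.
    obtain ⟨x, y, hxy, hxa, hxc, hya, hyc, hx, hy⟩ := exists_pair_ne hα (row a) (row c) hc
    obtain ⟨t, rfl, ht⟩ := hW x _ hx
    obtain ⟨u, rfl, hu⟩ := hW y _ hy
    rw [hf.step (c := c) (c' := t), hf.step (c := t) (c' := u), hf.step (c := u) (c' := c')]
    all_goals grind
  by_cases hr : row c = row c'
  · by_cases hc : col c = col c'
    · obtain ⟨s, hs1, hs2, hs3⟩ := exists_ne_three hα (col a) (col b) (col c)
      obtain ⟨r, hr1, hr2, hr3⟩ := exists_ne_three hα (row a) (row c) s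
      obtain ⟨t, rfl, rfl⟩ := hW r s hr3
      rw [hf.step (c := c) (c' := t), hf.step (c := t) (c' := c')]
      all_goals grind
    · exact key c c' hr hc h1 h2 h4 h2' h4'
  · by_cases hc : col c = col c'
    · obtain ⟨s, hs1, hs2, hs3⟩ := exists_ne_three hα (col a) (col b) (col c)
      by_cases h : row c' = s
      · obtain ⟨t, ht, rfl⟩ := hW (row c) s (fun h' => hr (h'.trans h.symm))
        rw [key c t ht.symm hs3.symm h1 h2 h4 hs1.symm hs2]
        apply hf.step <;> grind
      · obtain ⟨t, ht, rfl⟩ := hW _ s h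
        rw [hf.step (c := c) (c' := t), key t c' ht]
        all_goals grind
    · apply hf.step <;> grind

/-- A partial cocycle on a board with at least four rows and columns has a potential. This amounts
to the simple connectivity of chessboard complexes. -/
theorem exists_potential [Fintype α] (hf : IsPartialCocycle row col f) (hα : 4 ≤ Fintype.card α)
    (hW : ∀ r s, r ≠ s → ∃ w, row w = r ∧ col w = s) :
    ∃ g : W → A, ∀ a b, row a ≠ row b → col a ≠ col b → f a b = g a - g b := by
  -- The common value of `f a c + f c b` extends `f` to pairs in the same row or column; 0 is a
  -- default for pairs without an intermediate point.
  have hF : ∀ a b, ∃ x, ∀ c, row a ≠ row c → col a ≠ col c → row c ≠ row b → col c ≠ col b →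
      f a c + f c b = x := by
    intro a b
    by_cases hr : row a = row b
    · by_cases hne : ∃ t, row a ≠ row t ∧ col a ≠ col t ∧ row t ≠ row b ∧ col t ≠ col b
      · obtain ⟨t, h1, h2, h3, h4⟩ := hne
        exact ⟨f a t + f t b, fun c k1 k2 k3 k4 =>
          hf.eq_of_row_eq hα hW hr k1 k2 k4 h1 h2 h4⟩
      · exact ⟨0, fun c k1 k2 k3 k4 => absurd ⟨c, k1, k2, k3, k4⟩ hne⟩
    · by_cases hc : col a = col b
      · by_cases hne : ∃ t, row a ≠ row t ∧ col a ≠ col t ∧ row t ≠ row b ∧ col t ≠ col b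
        · obtain ⟨t, h1, h2, h3, h4⟩ := hne
          exact ⟨f a t + f t b, fun c k1 k2 k3 k4 =>
            hf.swap.eq_of_row_eq hα (fun r s h => (hW s r h.symm).imp fun _ h => h.symm)
              hc k2 k1 k3 h2 h1 h3⟩
        · exact ⟨0, fun c k1 k2 k3 k4 => absurd ⟨c, k1, k2, k3, k4⟩ hne⟩
      · exact ⟨f a b, fun c k1 k2 k3 k4 => hf.cocycle a c b k1 k2 k3 k4 hr hc⟩
  choose F hF using hF
  have hcompat : ∀ a b, row a ≠ row b → col a ≠ col b → F a b = f a b := by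
    intro a b hr hc
    obtain ⟨s, hs1, hs2, -⟩ := exists_ne_three hα (col a) (col b) (col b)
    obtain ⟨r, hr1, hr2, hr3⟩ := exists_ne_three hα (row a) (row b) s
    obtain ⟨t, rfl, rfl⟩ := hW r s hr3
    rw [← hF a b t hr1.symm hs1.symm hr2 hs2]
    exact hf.cocycle a t b hr1.symm hs1.symm hr2 hs2 hr hc
  rcases isEmpty_or_nonempty W with hemp | ⟨⟨z⟩⟩
  · exact ⟨fun _ => 0, fun a => (hemp.false a).elim⟩
  refine ⟨fun a => F a z, fun a b hr hc => ?_⟩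
  change f a b = F a z - F b z
  suffices h : (row a ≠ row z ∧ col a ≠ col z ∧ row b ≠ row z ∧ col b ≠ col z) ∨
      ∃ t, row t ≠ row a ∧ row t ≠ row b ∧ row t ≠ row z ∧ col t ≠ col a ∧ col t ≠ col b ∧
        col t ≠ col z by
    rcases h with ⟨h1, h2, h3, h4⟩ | ⟨t, h1, h2, h3, h4, h5, h6⟩
    · rw [hcompat a z h1 h2, hcompat b z h3 h4, ← hf.cocycle a b z hr hc h3 h4 h1 h2]
      abel
    · rw [← hF a z t h1.symm h4.symm h3 h6, ← hF b z t h2.symm h5.symm h3 h6,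
        ← hf.cocycle a t b h1.symm h4.symm h2 h5 hr hc, hf.antisymm b t h2.symm h5.symm]
      abel
  -- A coincidence of rows leaves at most two rows to avoid. So after choosing a column `s` off
  -- three columns, one can still demand that the row differ from `s`. Coinciding columns are
  -- symmetric.
  by_cases hrow : row a = row z ∨ row b = row z
  · obtain ⟨s, hs1, hs2, hs3⟩ := exists_ne_three hα (col a) (col b) (col z)
    obtain ⟨r, hr1, hr2, hr3⟩ := exists_ne_three hα (row a) (row b) s
    obtain ⟨t, rfl, rfl⟩ := hW r s hr3
    exact Or.inr ⟨t, by grind⟩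
  · by_cases hcol : col a = col z ∨ col b = col z
    · obtain ⟨r, hr1, hr2, hr3⟩ := exists_ne_three hα (row a) (row b) (row z)
      obtain ⟨s, hs1, hs2, hs3⟩ := exists_ne_three hα (col a) (col b) r
      obtain ⟨t, rfl, rfl⟩ := hW r s hs3.symm
      exact Or.inr ⟨t, by grind⟩
    · exact Or.inl (by grind)

end IsPartialCocycle

end Potential

/-! ### Reduced words and the loops made of two halves -/

section Words

variable {k : ℕ}

/-- The letter `b` may follow the letter `a` in a reduced word. -/
abbrev Follows (a b : Fin k × Bool) : Prop := a.1 = b.1 → a.2 = b.2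

theorem invLetter_invLetter (a : Fin k × Bool) : invLetter (invLetter a) = a := by
  simp [invLetter]

theorem invLetter_injective : Function.Injective (invLetter (k := k)) :=
  Function.LeftInverse.injective invLetter_invLetter

theorem invLetter_ne (a : Fin k × Bool) : invLetter a ≠ a := by
  intro h
  simpa [invLetter] using congrArg Prod.snd h

theorem follows_iff {a b : Fin k × Bool} : Follows a b ↔ b ≠ invLetter a := by
  obtain ⟨i, s⟩ := a
  obtain ⟨j, t⟩ := b
  simp only [Follows, invLetter, ne_eq, Prod.mk.injEq, not_and]
  constructor
  · rintro h rfl rfl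
    simpa using h rfl
  · rintro h rfl
    have := h rfl
    cases s <;> cases t <;> simp_all

theorem follows_self (a : Fin k × Bool) : Follows a a := fun _ => rfl

/-- A word in which no letter is followed by its inverse. -/
abbrev IsReduced (l : List (Fin k × Bool)) : Prop := l.IsChain Follows

/-- The inverse of a word. -/
def invWord (l : List (Fin k × Bool)) : List (Fin k × Bool) := (l.map invLetter).reverse

theorem invWord_invWord (l : List (Fin k × Bool)) : invWord (invWord l) = l := by
  simp [invWord, Function.comp_def, invLetter_invLetter]

@[simp]
theorem length_invWord (l : List (Fin k × Bool)) : (invWord l).length = l.length := by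
  simp [invWord]

theorem invWord_append (u v : List (Fin k × Bool)) :
    invWord (u ++ v) = invWord v ++ invWord u := by
  simp [invWord]

theorem invWord_cons (a : Fin k × Bool) (v : List (Fin k × Bool)) :
    invWord (a :: v) = invWord v ++ [invLetter a] := by
  simp [invWord]

theorem IsReduced.invWord {l : List (Fin k × Bool)} (h : IsReduced l) :
    IsReduced (invWord l) := by
  rw [IsReduced, ThinFatgraph.invWord, List.isChain_reverse, List.isChain_map]
  refine h.imp fun a b hab => ?_
  rw [follows_iff] at hab ⊢
  intro h'
  exact hab (by rw [h', invLetter_invLetter])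

theorem isLoop_coe {L : ℕ} {l : List (Fin k × Bool)} :
    IsLoop L (l : Cycle (Fin k × Bool)) ↔
      l.length = L ∧ IsReduced l ∧ ∀ x ∈ l.getLast?, ∀ y ∈ l.head?, Follows x y := by
  refine and_congr (by simp) ?_
  rcases l with - | ⟨a, l⟩
  · simp
  · rw [Cycle.chain_coe_cons, ← List.cons_append, List.isChain_append]
    simp only [List.isChain_singleton, List.head?_cons, Option.mem_some_iff, forall_eq', true_and]

theorem isLoop_append {L : ℕ} {u v : List (Fin k × Bool)} (hu : u ≠ []) (hv : v ≠ []) :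
    IsLoop L ((u ++ v : List (Fin k × Bool)) : Cycle (Fin k × Bool)) ↔
      u.length + v.length = L ∧ IsReduced (u ++ v) ∧
        Follows (v.getLast hv) (u.head hu) := by
  rw [isLoop_coe, List.length_append, List.getLast?_append, List.head?_append,
    List.getLast?_eq_some_getLast hv, List.head?_eq_some_head hu]
  simp

theorem isReduced_append {u v : List (Fin k × Bool)} (hu : u ≠ []) (hv : v ≠ []) :
    IsReduced (u ++ v) ↔ IsReduced u ∧ IsReduced v ∧ Follows (u.getLast hu) (v.head hv) := by
  rw [IsReduced, List.isChain_append, List.getLast?_eq_some_getLast hu, List.head?_eq_some_head hv]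
  simp

theorem isReduced_replicate (n : ℕ) (a : Fin k × Bool) : IsReduced (List.replicate n a) :=
  List.isChain_replicate_of_rel n (follows_self a)

/-- Reduced words of length `n + 1`. -/
def Word (k n : ℕ) : Type := {l : List (Fin k × Bool) // l.length = n + 1 ∧ IsReduced l}

namespace Word

variable {n : ℕ}

theorem ne_nil (w : Word k n) : w.1 ≠ [] := List.ne_nil_of_length_eq_add_one w.2.1

/-- The first letter. -/
def row (w : Word k n) : Fin k × Bool := w.1.head w.ne_nil

/-- The inverse word. -/
def inv (w : Word k n) : Word k n := ⟨invWord w.1, by simpa using w.2.1, w.2.2.invWord⟩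

theorem inv_inv (w : Word k n) : w.inv.inv = w := Subtype.ext (invWord_invWord w.1)

/-- The inverse of the last letter. -/
def col (w : Word k n) : Fin k × Bool := invLetter (w.1.getLast w.ne_nil)

theorem row_inv (w : Word k n) : w.inv.row = w.col := by
  simp [row, inv, col, invWord]

theorem col_inv (w : Word k n) : w.inv.col = w.row := by
  rw [← row_inv, inv_inv]

/-- Two words that differ both in their first and in their last letter. -/
def Compat (a b : Word k n) : Prop := a.row ≠ b.row ∧ a.col ≠ b.col

theorem Compat.symm {a b : Word k n} (h : a.Compat b) : b.Compat a := ⟨h.1.symm, h.2.symm⟩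

/-- The two inequalities exclude cancellation at the two junctions of the cyclic word. Taking the
inverse of the last letter as column makes inversion of words exchange rows and columns. -/
theorem isLoop_append_iff (a b : Word k n) :
    IsLoop (2 * (n + 1)) ((a.1 ++ b.1 : List (Fin k × Bool)) : Cycle (Fin k × Bool)) ↔
      a.Compat b.inv := by
  rw [isLoop_append a.ne_nil b.ne_nil, isReduced_append a.ne_nil b.ne_nil, a.2.1, b.2.1,
    follows_iff, follows_iff]
  simp only [a.2.2, b.2.2, true_and, Compat, row_inv, col_inv]
  exact ⟨fun h => ⟨h.2.2, h.2.1.symm⟩, fun h => ⟨by ring, h.2.symm, h.1⟩⟩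

theorem isLoop_append_inv {a b : Word k n} (h : a.Compat b) :
    IsLoop (2 * (n + 1)) ((a.1 ++ b.inv.1 : List (Fin k × Bool)) : Cycle (Fin k × Bool)) :=
  (isLoop_append_iff a b.inv).2 (by rwa [inv_inv])

/-- The loop `a b⁻¹`. -/
def Compat.loop {a b : Word k n} (h : a.Compat b) : Loop k (2 * (n + 1)) :=
  ⟨((a.1 ++ b.inv.1 : List (Fin k × Bool)) : Cycle (Fin k × Bool)), isLoop_append_inv h⟩

theorem Compat.loop_inv {a b : Word k n} (h : a.Compat b) : h.loop.inv = h.symm.loop := by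
  apply Subtype.ext
  change ((invWord (a.1 ++ invWord b.1) : List (Fin k × Bool)) : Cycle (Fin k × Bool)) =
    ((b.1 ++ invWord a.1 : List (Fin k × Bool)) : Cycle (Fin k × Bool))
  rw [invWord_append, invWord_invWord]

theorem Compat.inv {a b : Word k n} (h : a.Compat b) : a.inv.Compat b.inv := by
  simpa [Compat, row_inv, col_inv, and_comm] using h

/-- The cyclic word `a b⁻¹` may be read from its second half. This links the potential of a word to
that of its inverse. -/
theorem Compat.loop_rotate {a b : Word k n} (h : a.Compat b) : h.loop = h.symm.inv.loop := by
  apply Subtype.ext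
  change ((a.1 ++ invWord b.1 : List (Fin k × Bool)) : Cycle (Fin k × Bool)) =
    ((invWord b.1 ++ invWord (invWord a.1) : List (Fin k × Bool)) : Cycle (Fin k × Bool))
  rw [invWord_invWord, Cycle.coe_eq_coe]
  exact List.isRotated_append

end Word

theorem four_le_card_letters (hk : 2 ≤ k) : 4 ≤ Fintype.card (Fin k × Bool) := by
  simp
  omega

/-- The word is `r z … z s⁻¹` with `z` cancelling at neither end. In length two there is no `z`, and
`r ≠ s` is what makes `r s⁻¹` reduced. -/
theorem Word.exists_row_col (hk : 2 ≤ k) (n : ℕ) (hn : n ≠ 0) {r s : Fin k × Bool} (hrs : r ≠ s) :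
    ∃ w : Word k n, w.row = r ∧ w.col = s := by
  obtain ⟨n, rfl⟩ := Nat.exists_eq_succ_of_ne_zero hn
  obtain ⟨z, h1, h2, -⟩ := exists_ne_three (four_le_card_letters hk) (invLetter r) s s
  have hred : IsReduced (r :: (List.replicate n z ++ [invLetter s])) := by
    rcases n with - | n
    · rw [List.replicate_zero, List.nil_append]
      exact List.isChain_pair.2 (follows_iff.2 fun h => hrs (invLetter_injective h).symm)
    · rw [← List.singleton_append, isReduced_append (by simp) (by simp),
        isReduced_append (by simp) (by simp)]
      refine ⟨List.isChain_singleton _, ⟨isReduced_replicate _ _, List.isChain_singleton _, ?_⟩, ?_⟩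
      · rw [follows_iff]
        simpa using fun h => h2 (invLetter_injective h).symm
      · rw [follows_iff]
        simpa using h1
  refine ⟨⟨r :: (List.replicate n z ++ [invLetter s]), by simp, hred⟩, rfl, ?_⟩
  simp [Word.col, invLetter_invLetter]

end Words

/-! ### Functions on loops that vanish on pants and annuli -/

section Cocycles

variable {k n : ℕ} {A : Type*} [AddCommGroup A]

/-- A function on loops that is killed by the boundaries of good annuli and good pants. -/
structure IsLoopCocycle (φ : Loop k (2 * (n + 1)) → A) : Prop where
  inv : ∀ s, φ s + φ s.inv = 0
  pants : ∀ {a b c : Word k n} (hab : a.Compat b) (hbc : b.Compat c) (hca : c.Compat a),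
    φ hab.loop + φ hbc.loop + φ hca.loop = 0

namespace IsLoopCocycle

variable {φ : Loop k (2 * (n + 1)) → A}

/-- Annuli give antisymmetry and pants give the cocycle identity, so the chessboard argument
applies. -/
theorem exists_word_potential (hφ : IsLoopCocycle φ) (hk : 2 ≤ k) (hn : n ≠ 0) :
    ∃ g : Word k n → A, ∀ {a b : Word k n} (h : a.Compat b), φ h.loop = g a - g b := by
  classical
  let f : Word k n → Word k n → A := fun a b => if h : a.Compat b then φ h.loop else 0
  have hf : ∀ {a b : Word k n} (h : a.Compat b), f a b = φ h.loop := fun h => dif_pos h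
  have hanti : ∀ {a b : Word k n} (h : a.Compat b), φ h.loop = -φ h.symm.loop := by
    intro a b h
    rw [← h.loop_inv]
    exact eq_neg_of_add_eq_zero_left (hφ.inv _)
  have hcoc : IsPartialCocycle Word.row Word.col f := by
    constructor
    · intro a b h1 h2
      have h : a.Compat b := ⟨h1, h2⟩
      rw [hf h, hf h.symm, hanti h]
    · intro a b c h1 h2 h3 h4 h5 h6
      have hab : a.Compat b := ⟨h1, h2⟩
      have hbc : b.Compat c := ⟨h3, h4⟩
      have hac : a.Compat c := ⟨h5, h6⟩
      rw [hf hab, hf hbc, hf hac, hanti hac]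
      exact eq_neg_of_add_eq_zero_left (hφ.pants hab hbc hac.symm)
  obtain ⟨g, hg⟩ := hcoc.exists_potential (four_le_card_letters hk)
    (fun r s h => Word.exists_row_col hk n hn h)
  exact ⟨g, fun {a b} h => by rw [← hf h, hg a b h.1 h.2]⟩

/-- Reading `a b⁻¹` from either half gives `g a - g b = g b⁻¹ - g a⁻¹`, so `g a + g a⁻¹` agrees on
compatible words. Any two words have a common compatible word, so this sum is a constant `C`, and `φ
(u v) = g u - g v⁻¹` becomes symmetric in the halves. -/
theorem exists_list_potential (hφ : IsLoopCocycle φ) (hk : 2 ≤ k) (hn : n ≠ 0) :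
    ∃ (G : List (Fin k × Bool) → A) (C : A),
      (∀ u, u.length = n + 1 → IsReduced u → G u + G (invWord u) = C) ∧
      ∀ (s : Loop k (2 * (n + 1))) (u v : List (Fin k × Bool)), u.length = n + 1 →
        v.length = n + 1 → s.1 = ((u ++ v : List (Fin k × Bool)) : Cycle (Fin k × Bool)) →
        φ s = G u + G v - C := by
  classical
  obtain ⟨g, hg⟩ := hφ.exists_word_potential hk hn
  have hcompat : ∀ {a b : Word k n}, a.Compat b → g a + g a.inv = g b + g b.inv := by
    intro a b h
    have h1 := hg h
    rw [h.loop_rotate, hg h.symm.inv, sub_eq_sub_iff_add_eq_add] at h1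
    rw [← h1, add_comm]
  obtain ⟨C, hC⟩ : ∃ C, ∀ a : Word k n, g a + g a.inv = C := by
    rcases isEmpty_or_nonempty (Word k n) with hemp | ⟨⟨z⟩⟩
    · exact ⟨0, fun a => (hemp.false a).elim⟩
    · refine ⟨g z + g z.inv, fun a => ?_⟩
      have hα := four_le_card_letters hk
      obtain ⟨s, hs1, hs2, -⟩ := exists_ne_three hα a.col z.col z.col
      obtain ⟨r, hr1, hr2, hr3⟩ := exists_ne_three hα a.row z.row s
      obtain ⟨t, rfl, rfl⟩ := Word.exists_row_col hk n hn hr3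
      have h1 : a.Compat t := ⟨hr1.symm, hs1.symm⟩
      have h2 : t.Compat z := ⟨hr2, hs2⟩
      rw [hcompat h1, hcompat h2]
  let G : List (Fin k × Bool) → A :=
    fun l => if h : l.length = n + 1 ∧ IsReduced l then g ⟨l, h⟩ else 0
  have hG : ∀ l (h : l.length = n + 1 ∧ IsReduced l), G l = g ⟨l, h⟩ := fun l h => dif_pos h
  refine ⟨G, C, ?_, ?_⟩
  · intro u hu hr
    rw [hG u ⟨hu, hr⟩, hG (invWord u) ⟨by simpa using hu, hr.invWord⟩]
    exact hC ⟨u, hu, hr⟩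
  · intro s u v hu hv hs
    have hl := s.2
    rw [hs] at hl
    have hu0 : u ≠ [] := List.ne_nil_of_length_eq_add_one hu
    have hv0 : v ≠ [] := List.ne_nil_of_length_eq_add_one hv
    have hr := ((isLoop_append hu0 hv0).1 hl).2.1
    rw [isReduced_append hu0 hv0] at hr
    rw [hG u ⟨hu, hr.1⟩, hG v ⟨hv, hr.2.1⟩]
    have hc := (Word.isLoop_append_iff ⟨u, hu, hr.1⟩ ⟨v, hv, hr.2.1⟩).1 hl
    have hse : s = hc.loop := by
      apply Subtype.ext
      rw [hs]
      change _ = ((u ++ invWord (invWord v) : List (Fin k × Bool)) : Cycle (Fin k × Bool))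
      rw [invWord_invWord]
    rw [hse, hg hc, ← hC ⟨v, hv, hr.2.1⟩]
    abel

/-- Moving the cut of a loop by one letter replaces a half `x w` by `w y`. The change of `G` depends
only on `x` and `y` and is a difference `d x - d y`, so `G` is the sum of `d` over the letters plus
a constant. -/
theorem exists_letter_potential (hφ : IsLoopCocycle φ) (hk : 2 ≤ k) (hn : n ≠ 0) :
    ∃ (d : Fin k × Bool → A) (e : A), (∀ x, d x + d (invLetter x) = e) ∧
      ∀ s : Loop k (2 * (n + 1)), φ s = (s.1.toMultiset.map d).sum - (n + 1) • e := by
  obtain ⟨G, C, hC, hG⟩ := hφ.exists_list_potential hk hn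
  have hα := four_le_card_letters hk
  have hred : ∀ {x y : Fin k × Bool} {w : List (Fin k × Bool)}, w ≠ [] →
      IsReduced (x :: (w ++ [y])) →
      IsReduced w ∧ (∀ h : w ≠ [], Follows x (w.head h)) ∧ ∀ h : w ≠ [], Follows (w.getLast h) y := by
    intro x y w hw h
    rw [← List.singleton_append, isReduced_append (by simp) (by simp),
        isReduced_append hw (by simp)] at h
    simp only [List.head_append_of_ne_nil hw, List.getLast_singleton, List.head_singleton] at h
    exact ⟨h.2.1.1, fun _ => h.2.2, fun _ => h.2.1.2.2⟩
  have hred' : ∀ {x y z : Fin k × Bool}, z ≠ invLetter x → z ≠ invLetter y →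
      IsReduced (x :: (List.replicate n z ++ [y])) := by
    intro x y z hx hy
    rw [← List.singleton_append, isReduced_append (by simp) (by simp),
        isReduced_append (by simpa using hn) (by simp)]
    simp only [List.head_append_of_ne_nil (l := List.replicate n z) (by simpa using hn),
      List.getLast_singleton, List.head_singleton, List.head_replicate, List.getLast_replicate,
      follows_iff]
    exact ⟨List.isChain_singleton _, ⟨isReduced_replicate _ _, List.isChain_singleton _,
      fun h => hy (by rw [h, invLetter_invLetter])⟩, hx⟩
  -- the two ways to cut the loop `x w y v` in half
  have hrot : ∀ {x y : Fin k × Bool} {w v : List (Fin k × Bool)}, w.length = n → v.length = n →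
      IsReduced (x :: (w ++ [y])) → IsReduced (y :: (v ++ [x])) →
      G (x :: w) - G (w ++ [y]) = G (v ++ [x]) - G (y :: v) := by
    intro x y w v hw hv h1 h2
    have hw0 : w ≠ [] := by rintro rfl; exact hn hw.symm
    have hv0 : v ≠ [] := by rintro rfl; exact hn hv.symm
    have hloop : IsLoop (2 * (n + 1))
        (((x :: w) ++ (y :: v) : List (Fin k × Bool)) : Cycle (Fin k × Bool)) := by
      rw [isLoop_append (by simp) (by simp)]
      refine ⟨by simp [hw, hv]; ring, ?_, ?_⟩
      · have h3 : IsReduced ((x :: w) ++ [y]) := h1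
        have h4 : IsReduced ((y :: v) ++ [x]) := h2
        rw [isReduced_append (by simp) (by simp)] at h3 h4 ⊢
        exact ⟨h3.1, h4.1, h3.2.2⟩
      · have h4 : IsReduced ((y :: v) ++ [x]) := h2
        rw [isReduced_append (by simp) (by simp)] at h4
        exact h4.2.2
    have e1 := hG ⟨_, hloop⟩ (x :: w) (y :: v) (by simp [hw]) (by simp [hv]) rfl
    have e2 := hG ⟨_, hloop⟩ (w ++ [y]) (v ++ [x]) (by simp [hw]) (by simp [hv]) (by
      rw [Cycle.coe_eq_coe]
      have := List.isRotated_append (l := [x]) (l' := w ++ (y :: v))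
      simpa using this)
    rw [e1, sub_left_inj] at e2
    rw [sub_eq_sub_iff_add_eq_add, e2, add_comm]
  -- The right side of `hrot` does not involve `w`, so a single `v`, a power of a letter `z`, fixes
  -- the value for all `w`.
  have hD : ∀ x y, ∃ D, ∀ w : List (Fin k × Bool), w.length = n → IsReduced (x :: (w ++ [y])) →
      G (x :: w) - G (w ++ [y]) = D := by
    intro x y
    obtain ⟨z, h1, h2, -⟩ := exists_ne_three hα (invLetter x) (invLetter y) x
    exact ⟨_, fun w hw hr => hrot hw (List.length_replicate ..) hr (hred' h2 h1)⟩
  choose D hD using hD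
  have hanti : ∀ x y, D x y = -D y x := by
    intro x y
    obtain ⟨z, h1, h2, -⟩ := exists_ne_three hα (invLetter x) (invLetter y) x
    rw [← hD x y (List.replicate n z) (List.length_replicate ..) (hred' h1 h2),
      ← hD y x (List.replicate n z) (List.length_replicate ..) (hred' h2 h1),
      hrot (List.length_replicate ..) (List.length_replicate ..) (hred' h1 h2) (hred' h2 h1), neg_sub]
  -- The words `x tⁿ`, `tⁿ⁺¹`, `tⁿ y` make the sum telescope.
  have hmid : ∀ x t y, t ≠ invLetter x → t ≠ invLetter y → D x t + D t y = D x y := by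
    intro x t y hx hy
    have ht : t ≠ invLetter t := (invLetter_ne t).symm
    rw [← hD x t (List.replicate n t) (List.length_replicate ..) (hred' hx ht),
      ← hD t y (List.replicate n t) (List.length_replicate ..) (hred' ht hy),
      ← hD x y (List.replicate n t) (List.length_replicate ..) (hred' hx hy)]
    rw [← List.replicate_succ, List.replicate_succ']
    abel
  have hcoc : ∀ x y z, D x y + D y z = D x z := by
    intro x y z
    obtain ⟨t, h1, h2, h3⟩ := exists_ne_three hα (invLetter x) (invLetter y) (invLetter z)
    rw [← hmid x t y h1 h2, ← hmid y t z h2 h3, ← hmid x t z h1 h3, hanti t y]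
    abel
  have hinv : ∀ x y, D x y = D (invLetter y) (invLetter x) := by
    intro x y
    obtain ⟨z, h1, h2, -⟩ := exists_ne_three hα (invLetter x) (invLetter y) x
    have hr := hred' h1 h2
    have hr' := hr.invWord
    rw [invWord_cons, invWord_append] at hr'
    have e1 := hC (x :: List.replicate n z) (by simp)
      (List.IsChain.left_of_append (l₂ := [y]) (by simpa using hr))
    have e2 := hC (List.replicate n z ++ [y]) (by simp) hr.tail
    rw [← hD x y _ (List.length_replicate ..) hr,
      ← hD (invLetter y) (invLetter x) (invWord (List.replicate n z)) (by simp)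
        (by simpa [invWord] using hr')]
    rw [invWord_cons] at e1
    rw [invWord_append] at e2
    rw [eq_sub_of_add_eq e1, eq_sub_of_add_eq e2]
    simp [invWord]
  obtain ⟨x₀⟩ : Nonempty (Fin k × Bool) := Fintype.card_pos_iff.1 (by omega)
  have hd : ∀ x y, D x y = D x x₀ - D y x₀ := fun x y => by rw [← hcoc x y x₀]; abel
  set d : Fin k × Bool → A := fun x => D x x₀ with hd_def
  obtain ⟨e, he⟩ : ∃ e, ∀ x, d x + d (invLetter x) = e := by
    refine ⟨d x₀ + d (invLetter x₀), fun x => ?_⟩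
    have := hinv x x₀
    rw [hd x x₀, hd (invLetter x₀)] at this
    rw [add_comm (d x₀)]
    exact (sub_eq_sub_iff_add_eq_add.1 this)
  -- A window of length `n + 1` slides from the start of `u ++ v` to its end; each shift preserves
  -- `G` minus the sum of `d`.
  have htel : ∀ v u : List (Fin k × Bool), u.length = n + 1 → IsReduced (u ++ v) →
      G u - (u.map d).sum =
        G ((u ++ v).drop v.length) - (((u ++ v).drop v.length).map d).sum := by
    intro v
    induction v with
    | nil => intro u _ _; simp
    | cons y v ih =>
      rintro (- | ⟨x, w⟩) hu hr
      · simp at hu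
      · have hw : w.length = n := by simpa using hu
        have h1 := ih (w ++ [y]) (by simp [hw]) (by simpa using hr.tail)
        have h2 := hD x y w hw (List.IsChain.left_of_append (l₂ := v) (by simpa using hr))
        have h3 : ((x :: w) ++ y :: v).drop (y :: v).length = ((w ++ [y]) ++ v).drop v.length := by
          simp
        rw [h3, ← h1]
        rw [hd x y] at h2
        rw [sub_eq_iff_eq_add] at h2
        rw [h2]
        simp only [hd_def, List.map_cons, List.sum_cons, List.map_append, List.sum_append,
          List.map_nil, List.sum_nil]
        abel
  -- Every `u` slides to the reference word `x₀ⁿ⁺¹` through `zⁿ⁺¹`, with `z` chosen to cancel with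
  -- neither.
  obtain ⟨c, hc⟩ : ∃ c, ∀ u, u.length = n + 1 → IsReduced u → G u - (u.map d).sum = c := by
    have hpair : ∀ u v : List (Fin k × Bool), u.length = n + 1 → v.length = n + 1 →
        IsReduced (u ++ v) → G u - (u.map d).sum = G v - (v.map d).sum := by
      intro u v hu hv hr
      have h3 : (u ++ v).drop v.length = v := by rw [hv, ← hu, List.drop_left]
      rw [htel v u hu hr, h3]
    refine ⟨G (List.replicate (n + 1) x₀) - ((List.replicate (n + 1) x₀).map d).sum,
      fun u hu hr => ?_⟩
    have hu0 : u ≠ [] := List.ne_nil_of_length_eq_add_one hu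
    obtain ⟨z, h1, h2, -⟩ := exists_ne_three hα (invLetter (u.getLast hu0)) (invLetter x₀) x₀
    have hz : IsReduced (List.replicate (n + 1) z) := isReduced_replicate _ _
    rw [hpair u (List.replicate (n + 1) z) hu (by simp), hpair (List.replicate (n + 1) z)
      (List.replicate (n + 1) x₀) (by simp) (by simp)]
    · rw [isReduced_append (by simp) (by simp)]
      refine ⟨hz, isReduced_replicate _ _, ?_⟩
      rw [follows_iff, List.head_replicate, List.getLast_replicate]
      exact fun h => h2 (by rw [h, invLetter_invLetter])
    · rw [isReduced_append hu0 (by simp)]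
      refine ⟨hr, hz, ?_⟩
      rw [follows_iff, List.head_replicate]
      exact h1
  have hG' : ∀ u, u.length = n + 1 → IsReduced u → G u = (u.map d).sum + c := fun u h1 h2 => by
    rw [← hc u h1 h2]; abel
  have hsum : ∀ u : List (Fin k × Bool),
      (u.map d).sum + ((invWord u).map d).sum = u.length • e := by
    intro u
    induction u with
    | nil => simp [invWord]
    | cons a u ih =>
      rw [invWord_cons, List.length_cons, succ_nsmul, ← ih, ← he a]
      simp only [List.map_cons, List.sum_cons, List.map_append, List.sum_append,
          List.map_nil, List.sum_nil]
      abel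
  have hCe : C = (n + 1) • e + c + c := by
    have hz : IsReduced (List.replicate (n + 1) x₀) := isReduced_replicate _ _
    have hlen : (List.replicate (n + 1) x₀).length = n + 1 := by simp
    have hs := hsum (List.replicate (n + 1) x₀)
    rw [hlen] at hs
    rw [← hC _ hlen hz, hG' _ hlen hz, hG' _ (by simp) hz.invWord, ← hs]
    abel
  refine ⟨d, e, he, fun s => ?_⟩
  obtain ⟨l, hl⟩ : ∃ l : List (Fin k × Bool), s.1 = (l : Cycle (Fin k × Bool)) :=
    ⟨s.1.out, (Quotient.out_eq s.1).symm⟩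
  have hlen : l.length = 2 * (n + 1) := by
    have := s.2.1
    rwa [hl, Cycle.length_coe] at this
  have hu : (l.take (n + 1)).length = n + 1 := by simp; omega
  have hv : (l.drop (n + 1)).length = n + 1 := by simp; omega
  have hloop := s.2
  rw [hl, isLoop_coe, ← List.take_append_drop (n + 1) l] at hloop
  have hr := hloop.2.1
  rw [hG s (l.take (n + 1)) (l.drop (n + 1)) hu hv (by rw [List.take_append_drop, hl]),
    hG' _ hu hr.left_of_append, hG' _ hv hr.right_of_append, hCe, hl, Cycle.coe_toMultiset,
    Multiset.map_coe, Multiset.sum_coe]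
  conv_rhs => rw [← List.take_append_drop (n + 1) l, List.map_append, List.sum_append]
  abel

end IsLoopCocycle

end Cocycles

/-! ### Vanishing on homologically trivial vectors -/

section

variable {k n : ℕ} {A : Type*} [AddCommGroup A]

theorem homologyMap_intCast_apply {L : ℕ} (v : Loop k L → ℤ) (i : Fin k) :
    homologyMap k L (fun s => (v s : ℚ)) i =
      ((∑ s, v s * ((s.1.toMultiset.count (i, true) : ℤ) - s.1.toMultiset.count (i, false)) : ℤ)
        : ℚ) := by
  rw [homologyMap, Fintype.linearCombination_apply, Finset.sum_apply]
  push_cast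
  rfl

/-- Homological triviality balances each generator against its inverse, and each balanced pair
contributes `e`. The number of pairs, counted with the coefficients `v`, is `(n + 1) * ∑ v`, which
cancels the constant term of `φ`. -/
theorem IsLoopCocycle.sum_eq_zero_of_two_le {φ : Loop k (2 * (n + 1)) → A} (hφ : IsLoopCocycle φ)
    (hk : 2 ≤ k) (hn : n ≠ 0) {v : Loop k (2 * (n + 1)) → ℤ}
    (hv : homologyMap k _ (fun s => (v s : ℚ)) = 0) : ∑ s, v s • φ s = 0 := by
  obtain ⟨d, e, he, hd⟩ := hφ.exists_letter_potential hk hn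
  have hi : ∀ i : Fin k, ∑ s, v s * (s.1.toMultiset.count (i, true) : ℤ) =
      ∑ s, v s * (s.1.toMultiset.count (i, false) : ℤ) := by
    intro i
    have h := homologyMap_intCast_apply v i
    rw [hv, Pi.zero_apply, eq_comm, Int.cast_eq_zero] at h
    simpa only [mul_sub, Finset.sum_sub_distrib, sub_eq_zero] using h
  have hdf : ∀ i : Fin k, d (i, false) = e - d (i, true) := fun i =>
    eq_sub_of_add_eq' (he (i, true))
  have hsum : ∀ s : Loop k (2 * (n + 1)), (s.1.toMultiset.map d).sum =
      ∑ i : Fin k, ((s.1.toMultiset.count (i, true) : ℤ) • d (i, true) +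
        (s.1.toMultiset.count (i, false) : ℤ) • d (i, false)) := by
    intro s
    rw [Finset.sum_multiset_map_count, Finset.sum_subset (Finset.subset_univ _),
      Fintype.sum_prod_type]
    · simp [natCast_zsmul]
    · intro x _ hx
      rw [Multiset.mem_toFinset] at hx
      rw [Multiset.count_eq_zero_of_notMem hx, zero_smul]
  have hlen : ∀ s : Loop k (2 * (n + 1)), ∑ i : Fin k, ((s.1.toMultiset.count (i, true) : ℤ) +
        (s.1.toMultiset.count (i, false) : ℤ)) = 2 * (n + 1) := by
    intro s
    have h1 : Multiset.card s.1.toMultiset = 2 * (n + 1) := by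
      rw [Cycle.card_toMultiset, s.2.1]
    rw [← Multiset.sum_count_eq_card (s := Finset.univ) (fun a _ => Finset.mem_univ a),
      Fintype.sum_prod_type] at h1
    have h2 := congrArg (fun t : ℕ => (t : ℤ)) h1
    simpa using h2
  set T : ℤ := ∑ s, v s
  -- Twice the number of pairs is the total number of letters. The factor 2 is cancelled in ℤ, since
  -- `A` may have torsion.
  have hT : ∑ i : Fin k, ∑ s, v s * (s.1.toMultiset.count (i, false) : ℤ) = (n + 1) * T := by
    have h1 : ∑ s, v s * ∑ i : Fin k, ((s.1.toMultiset.count (i, true) : ℤ) +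
        (s.1.toMultiset.count (i, false) : ℤ)) = 2 * ((n + 1) * T) := by
      simp only [hlen, ← Finset.sum_mul]
      ring
    simp only [Finset.mul_sum, mul_add, Finset.sum_add_distrib] at h1
    rw [Finset.sum_comm, Finset.sum_congr rfl (fun i _ => hi i),
      Finset.sum_comm (s := (Finset.univ : Finset (Loop k (2 * (n + 1)))))] at h1
    linarith
  have hmain : ∑ s, v s • φ s = ∑ i : Fin k,
      ((∑ s, v s * (s.1.toMultiset.count (i, true) : ℤ)) • d (i, true) +
        (∑ s, v s * (s.1.toMultiset.count (i, false) : ℤ)) • d (i, false)) -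
        T • ((n + 1) • e) := by
    simp only [hd, hsum, smul_sub, Finset.sum_sub_distrib, Finset.smul_sum, smul_add, smul_smul,
      Finset.sum_smul, Finset.sum_add_distrib, T]
    congr 2 <;> exact Finset.sum_comm
  rw [hmain]
  simp only [hi, hdf, smul_sub, add_sub_cancel, ← Finset.sum_smul, hT]
  rw [mul_comm, mul_smul, sub_eq_zero, ← natCast_zsmul]
  push_cast
  rfl

theorem loop_fin_one_eq {L : ℕ} (s : Loop 1 L) :
    ∃ b, s.1 = ((List.replicate L ((0 : Fin 1), b) : List (Fin 1 × Bool)) : Cycle _) := by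
  obtain ⟨c, hc⟩ := s
  induction c using Quotient.inductionOn' with
  | h l =>
    obtain ⟨h1, h2, -⟩ := isLoop_coe.1 hc
    rcases l with - | ⟨a, l⟩
    · exact ⟨true, by subst h1; rfl⟩
    · refine ⟨a.2, congrArg (fun l : List (Fin 1 × Bool) => (l : Cycle (Fin 1 × Bool))) ?_⟩
      have h3 : (a :: l).IsChain (· = ·) :=
        h2.imp fun x y h => Prod.ext (Subsingleton.elim _ _) (h (Subsingleton.elim _ _))
      rw [List.isChain_cons_eq_iff_eq_replicate] at h3
      rw [← h1, List.eq_replicate_iff]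
      refine ⟨rfl, fun x hx => ?_⟩
      have h4 : x = a := by
        rcases List.mem_cons.1 hx with h | h
        · exact h
        · rw [h3] at h
          exact List.eq_of_mem_replicate h
      exact Prod.ext (Subsingleton.elim _ _) (by rw [h4])

/-- In rank one the only loops are the two powers of the generator, mutually inverse, so the annulus
relation alone suffices; `σ` is the sign relative to a chosen loop. -/
theorem sum_smul_eq_zero_of_fin_one {L : ℕ} (hL : 0 < L) {φ : Loop 1 L → A}
    (hφ : ∀ s, φ s + φ s.inv = 0) {v : Loop 1 L → ℤ}
    (hv : homologyMap 1 _ (fun s => (v s : ℚ)) = 0) : ∑ s, v s • φ s = 0 := by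
  choose b hb using loop_fin_one_eq (L := L)
  rcases isEmpty_or_nonempty (Loop 1 L) with hemp | ⟨⟨z⟩⟩
  · simp
  let σ : Loop 1 L → ℤ := fun s => if b s = b z then 1 else -1
  have hinv : ∀ s, s.inv.1 = ((List.replicate L ((0 : Fin 1), !(b s)) : List (Fin 1 × Bool)) : Cycle _) := by
    intro s
    change (s.1.map invLetter).reverse = _
    rw [hb s, Cycle.map_coe, Cycle.reverse_coe]
    simp [invLetter]
  have hφσ : ∀ s, φ s = σ s • φ z := by
    intro s
    by_cases h : b s = b z
    · have : s = z := Subtype.ext (by rw [hb s, hb z, h])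
      simp [σ, this]
    · have : s = z.inv := Subtype.ext (by
        rw [hb s, hinv z]
        congr 3
        cases h1 : b s <;> cases h2 : b z <;> simp_all)
      have h2 : σ s = -1 := if_neg h
      rw [h2, neg_smul, one_smul, this]
      exact eq_neg_of_add_eq_zero_right (hφ z)
  have hcount : ∀ s : Loop 1 L, (s.1.toMultiset.count (0, true) : ℤ) -
      s.1.toMultiset.count (0, false) = σ s * (if b z then (L : ℤ) else -L) := by
    intro s
    rw [hb s, Cycle.coe_toMultiset, Multiset.coe_replicate, Multiset.count_replicate,
      Multiset.count_replicate]
    cases h1 : b s <;> cases h2 : b z <;> simp [σ, h1, h2]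
  have h := homologyMap_intCast_apply v 0
  rw [hv, Pi.zero_apply, eq_comm, Int.cast_eq_zero] at h
  simp only [hcount, ← mul_assoc, ← Finset.sum_mul] at h
  have hne : (if b z then (L : ℤ) else -L) ≠ 0 := by split_ifs <;> omega
  have h0 := (mul_eq_zero.1 h).resolve_right hne
  rw [Finset.sum_congr rfl (g := fun s => (v s * σ s) • φ z) fun s _ => by
    rw [mul_smul, ← hφσ s], ← Finset.sum_smul, h0, zero_smul]

/-- Every homologically trivial integral vector is an integral combination of boundaries of good
annuli and good pairs of pants. -/
theorem IsLoopCocycle.sum_eq_zero {φ : Loop k (2 * (n + 1)) → A} (hφ : IsLoopCocycle φ)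
    (hn : n ≠ 0) {v : Loop k (2 * (n + 1)) → ℤ}
    (hv : homologyMap k _ (fun s => (v s : ℚ)) = 0) : ∑ s, v s • φ s = 0 := by
  -- Rank zero has no loops of positive length, and rank one has too few letters for the chessboard
  -- argument.
  rcases k with - | - | k
  · refine Finset.sum_eq_zero fun s _ => ?_
    have h1 := s.2.1
    rw [← Cycle.card_toMultiset] at h1
    obtain ⟨a, -⟩ := Multiset.card_pos_iff_exists_mem.1 (by rw [h1]; omega)
    exact a.1.elim0
  · exact sum_smul_eq_zero_of_fin_one (by omega) hφ.inv hv
  · exact hφ.sum_eq_zero_of_two_le (by omega) hn hv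

end

/-! ### Short permutation cycles, and fatgraphs glued from polygons -/

theorem sameCycle_mem {α : Type*} {p : Equiv.Perm α} {S : Set α} (h : ∀ x, x ∈ S ↔ p x ∈ S)
    {d e : α} (hd : d ∈ S) (hde : p.SameCycle d e) : e ∈ S := by
  obtain ⟨z, rfl⟩ := hde
  induction z using Int.induction_on with
  | zero => simpa using hd
  | succ i ih =>
    rw [add_comm, zpow_add, zpow_one, Equiv.Perm.mul_apply]
    exact (h _).1 ih
  | pred i ih =>
    rw [h, ← Equiv.Perm.mul_apply, ← zpow_one_add]
    simpa using ih

theorem sameCycle_iff_of_sq {α : Type*} {p : Equiv.Perm α} {d e : α} (h : p (p d) = d) :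
    p.SameCycle d e ↔ e = d ∨ e = p d := by
  constructor
  · refine sameCycle_mem (S := {x | x = d ∨ x = p d}) (fun x => ?_) (Or.inl rfl)
    constructor
    · rintro (rfl | rfl)
      · exact Or.inr rfl
      · exact Or.inl h
    · rintro (hx | hx)
      · exact Or.inr (p.injective (by rw [hx, h]))
      · exact Or.inl (p.injective hx)
  · rintro (rfl | rfl)
    · exact Equiv.Perm.SameCycle.refl p _
    · exact ⟨1, by simp⟩

theorem sameCycle_iff_of_cube {α : Type*} {p : Equiv.Perm α} {d e : α} (h : p (p (p d)) = d) :
    p.SameCycle d e ↔ e = d ∨ e = p d ∨ e = p (p d) := by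
  constructor
  · refine sameCycle_mem (S := {x | x = d ∨ x = p d ∨ x = p (p d)}) (fun x => ?_) (Or.inl rfl)
    constructor
    · rintro (rfl | rfl | rfl)
      · exact Or.inr (Or.inl rfl)
      · exact Or.inr (Or.inr rfl)
      · exact Or.inl h
    · rintro (hx | hx | hx)
      · exact Or.inr (Or.inr (p.injective (by rw [hx, h])))
      · exact Or.inl (p.injective hx)
      · exact Or.inr (Or.inl (p.injective hx))
  · rintro (rfl | rfl | rfl)
    · exact Equiv.Perm.SameCycle.refl p _
    · exact ⟨1, by simp⟩
    · exact ⟨2, by simp [pow_two]⟩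

section Letters

variable {k L : ℕ} [NeZero L]

/-- The letter of a cyclic word at a position modulo its length. -/
def letterAt (l : List (Fin k × Bool)) (hl : l.length = L) (i : ZMod L) : Fin k × Bool :=
  l[i.val]'(by rw [hl]; exact ZMod.val_lt i)

theorem val_add_one_mod (i : ZMod L) : (i + 1).val = (i.val + 1) % L := by
  rw [ZMod.val_add, ZMod.val_one_eq_one_mod]
  simp

theorem follows_letterAt {l : List (Fin k × Bool)} (hl : IsLoop L (l : Cycle (Fin k × Bool)))
    (hlen : l.length = L) (i : ZMod L) :
    Follows (letterAt l hlen i) (letterAt l hlen (i + 1)) := by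
  obtain ⟨-, h2, h3⟩ := isLoop_coe.1 hl
  have hi := ZMod.val_lt i
  unfold letterAt
  by_cases h : i.val + 1 < L
  · have h1 : (i + 1).val = i.val + 1 := by rw [val_add_one_mod, Nat.mod_eq_of_lt h]
    simp only [h1]
    exact List.isChain_iff_getElem.1 h2 i.val (by omega)
  · have h0 : i.val = l.length - 1 := by omega
    have h1 : (i + 1).val = 0 := by
      rw [val_add_one_mod, show i.val + 1 = L by omega, Nat.mod_self]
    simp only [h1, h0]
    have hne : l ≠ [] := by
      rintro rfl
      exact NeZero.ne L hlen.symm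
    apply h3
    · rw [List.getLast?_eq_some_getLast hne, List.getLast_eq_getElem]
      rfl
    · rw [List.head?_eq_some_head hne, List.head_eq_getElem]
      rfl

end Letters

/-- A fatgraph presented by its faces: polygons with `L` sides that are labelled by loops, and whose
sides are glued in pairs, such that two or three corners meet at each vertex. -/
structure Gluing (k L : ℕ) [NeZero L] where
  /-- the polygons -/
  Face : Type
  finFace : Finite Face
  /-- the word along the sides of a polygon -/
  word : Face → List (Fin k × Bool)
  isLoop : ∀ f, IsLoop L (word f : Cycle (Fin k × Bool))
  length_word : ∀ f, (word f).length = L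
  /-- the pairing of the sides -/
  rev : Face × ZMod L → Face × ZMod L
  rev_rev : ∀ d, rev (rev d) = d
  rev_ne : ∀ d, rev d ≠ d
  letterAt_rev : ∀ d, letterAt (word (rev d).1) (length_word _) (rev d).2 =
    invLetter (letterAt (word d.1) (length_word _) d.2)
  /-- the vertex rotation has order two or three at each corner -/
  corner : ∀ d, (fun e : Face × ZMod L => ((rev e).1, (rev e).2 + 1))^[2] d = d ∨
    (fun e : Face × ZMod L => ((rev e).1, (rev e).2 + 1))^[3] d = d

namespace Gluing

variable {k L : ℕ} [NeZero L] (G : Gluing k L)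

/-- One step along the boundary of a polygon. -/
def faceStep : Equiv.Perm (G.Face × ZMod L) := (Equiv.refl _).prodCongr (Equiv.addRight 1)

theorem faceStep_apply (d : G.Face × ZMod L) : G.faceStep d = (d.1, d.2 + 1) := rfl

/-- The pairing of the sides as a permutation. -/
def revPerm : Equiv.Perm (G.Face × ZMod L) := Function.Involutive.toPerm G.rev G.rev_rev

/-- Rotation about a vertex. -/
def next : Equiv.Perm (G.Face × ZMod L) := G.faceStep * G.revPerm

theorem next_apply (d : G.Face × ZMod L) : G.next d = ((G.rev d).1, (G.rev d).2 + 1) := rfl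

theorem next_corner (d : G.Face × ZMod L) :
    G.next (G.next d) = d ∨ G.next (G.next (G.next d)) = d :=
  G.corner d

/-- The label of a side. -/
def label (d : G.Face × ZMod L) : Fin k × Bool := letterAt (G.word d.1) (G.length_word _) d.2

/-- The sides `rev d` and `next d` are consecutive on a polygon, so reducedness of its word forbids
equal labels. With at most three darts at a vertex, any two are neighbours in the cyclic order, so
this gives local injectivity. -/
theorem label_next_ne (d : G.Face × ZMod L) : G.label (G.next d) ≠ G.label d := by
  have h := follows_letterAt (G.isLoop (G.rev d).1) (G.length_word _) (G.rev d).2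
  rw [follows_iff, G.letterAt_rev, invLetter_invLetter] at h
  exact h

theorem next_ne (d : G.Face × ZMod L) : G.next d ≠ d := fun h =>
  G.label_next_ne d (by rw [h])

/-- The fatgraph obtained from a gluing. -/
def toFatgraph : Fatgraph k where
  Vertex := Quotient (Equiv.Perm.SameCycle.setoid G.next)
  Dart := G.Face × ZMod L
  finVertex := by
    have := G.finFace
    exact Quotient.finite _
  finDart := by
    have := G.finFace
    infer_instance
  src := Quotient.mk _
  rev := G.revPerm
  next := G.next
  label := G.label
  rev_rev := G.rev_rev
  rev_ne := G.rev_ne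
  src_eq_iff := fun _ _ => Quotient.eq
  src_surjective := Quotient.mk_surjective
  label_rev := G.letterAt_rev
  folded := by
    intro d e hde hl
    have h : G.next.SameCycle d e := Quotient.exact hde
    rcases G.next_corner d with h2 | h3
    · rcases (sameCycle_iff_of_sq h2).1 h with rfl | rfl
      · rfl
      · exact absurd hl.symm (G.label_next_ne d)
    · rcases (sameCycle_iff_of_cube h3).1 h with rfl | rfl | rfl
      · rfl
      · exact absurd hl.symm (G.label_next_ne d)
      · have := G.label_next_ne (G.next (G.next d))
        rw [h3] at this
        exact absurd hl this

theorem face_toFatgraph : G.toFatgraph.face = G.faceStep := by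
  change G.faceStep * G.revPerm * G.revPerm = G.faceStep
  rw [mul_assoc]
  have : G.revPerm * G.revPerm = 1 := Equiv.ext G.rev_rev
  rw [this, mul_one]

theorem faceStep_iterate (n : ℕ) (d : G.Face × ZMod L) : G.faceStep^[n] d = (d.1, d.2 + n) := by
  induction n with
  | zero => simp
  | succ n ih => rw [Function.iterate_succ_apply', ih, faceStep_apply]; push_cast; rw [add_assoc]

theorem sameCycle_faceStep {d e : G.Face × ZMod L} : G.faceStep.SameCycle d e ↔ d.1 = e.1 := by
  constructor
  · intro h
    exact (sameCycle_mem (S := {x | x.1 = d.1}) (fun x => Iff.rfl) rfl h).symm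
  · intro h
    refine ⟨((e.2 - d.2).val : ℕ), ?_⟩
    rw [zpow_natCast, ← Equiv.Perm.iterate_eq_pow, faceStep_iterate]
    rw [ZMod.natCast_zmod_val, h, add_sub_cancel]

/-- The period is that of the sides, not of their labels: a loop that is a proper power is still
read in full length. -/
theorem minimalPeriod_faceStep (d : G.Face × ZMod L) :
    Function.minimalPeriod G.faceStep d = L := by
  have h : ∀ n, Function.IsPeriodicPt G.faceStep n d ↔ L ∣ n := by
    intro n
    rw [Function.IsPeriodicPt, Function.IsFixedPt, faceStep_iterate, Prod.ext_iff,
      ← ZMod.natCast_eq_zero_iff]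
    simp
  apply Nat.dvd_antisymm
  · exact ((h L).2 dvd_rfl).minimalPeriod_dvd
  · exact (h _).1 (Function.isPeriodicPt_minimalPeriod _ _)

theorem sameCycle_face {d e : G.Face × ZMod L} :
    G.toFatgraph.face.SameCycle d e ↔ d.1 = e.1 :=
  (iff_of_eq (congrArg (fun p : Equiv.Perm (G.Face × ZMod L) => p.SameCycle d e)
    G.face_toFatgraph)).trans G.sameCycle_faceStep

/-- The boundary components are the polygons. -/
def boundaryEquiv : G.Face ≃ G.toFatgraph.Boundary :=
  Equiv.ofBijective (fun f => Quotient.mk _ (f, 0)) (by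
    constructor
    · intro f g h
      exact G.sameCycle_face.1 (Quotient.exact h)
    · intro b
      induction b using Quotient.inductionOn with
      | h d =>
        exact ⟨d.1, Quotient.sound (G.sameCycle_face.2 rfl)⟩)

theorem boundaryWord_boundaryEquiv (f : G.Face) :
    G.toFatgraph.boundaryWord (G.boundaryEquiv f) = (G.word f : Cycle (Fin k × Bool)) := by
  refine (congrArg (fun p : Equiv.Perm (G.Face × ZMod L) =>
    (Function.periodicOrbit p (f, 0)).map G.label) G.face_toFatgraph).trans ?_
  rw [Function.periodicOrbit_def, minimalPeriod_faceStep, Cycle.map_coe, List.map_map]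
  congr 1
  apply List.ext_getElem
  · simp [G.length_word]
  · intro i h1 h2
    have hi : i < L := by simpa using h1
    simp only [List.getElem_map, List.getElem_range, Function.comp_apply, faceStep_iterate, zero_add,
      label, letterAt, ZMod.val_natCast, Nat.mod_eq_of_lt hi]

theorem hasBoundaryIn : G.toFatgraph.HasBoundaryIn L := by
  intro b
  obtain ⟨f, rfl⟩ := G.boundaryEquiv.surjective b
  rw [boundaryWord_boundaryEquiv]
  exact G.isLoop f

theorem card_boundary : Nat.card G.toFatgraph.Boundary = Nat.card G.Face :=
  (Nat.card_congr G.boundaryEquiv).symm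

theorem card_boundaryWord_eq (c : Cycle (Fin k × Bool)) :
    Nat.card {b // G.toFatgraph.boundaryWord b = c} =
      Nat.card {f // (G.word f : Cycle (Fin k × Bool)) = c} := by
  refine (Nat.card_congr (G.boundaryEquiv.subtypeEquiv fun f => ?_)).symm
  rw [boundaryWord_boundaryEquiv]

theorem valence_src_eq_ncard (d : G.Face × ZMod L) :
    G.toFatgraph.valence (G.toFatgraph.src d) = {e | G.next.SameCycle d e}.ncard := by
  change Nat.card {e // G.toFatgraph.src e = G.toFatgraph.src d} = _
  rw [← Nat.card_coe_set_eq]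
  refine Nat.card_congr (Equiv.subtypeEquivRight fun e => ?_)
  exact (G.toFatgraph.src_eq_iff e d).trans Equiv.Perm.sameCycle_comm

theorem valence_eq_two {d : G.Face × ZMod L} (h : G.next (G.next d) = d) :
    G.toFatgraph.valence (G.toFatgraph.src d) = 2 := by
  rw [valence_src_eq_ncard]
  simp only [sameCycle_iff_of_sq h]
  exact Set.ncard_pair (G.next_ne d).symm

theorem valence_eq_three {d : G.Face × ZMod L} (h : G.next (G.next (G.next d)) = d) :
    G.toFatgraph.valence (G.toFatgraph.src d) = 3 := by
  rw [valence_src_eq_ncard]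
  simp only [sameCycle_iff_of_cube h]
  rw [show {e | e = d ∨ e = G.next d ∨ e = G.next (G.next d)} = {d, G.next d, G.next (G.next d)}
    from rfl, Set.ncard_eq_three]
  refine ⟨_, _, _, (G.next_ne d).symm, fun h' => ?_, (G.next_ne _).symm, rfl⟩
  rw [← h'] at h
  exact G.next_ne d h

theorem isTrivalent : G.toFatgraph.IsTrivalent := by
  intro v
  obtain ⟨d, rfl⟩ := G.toFatgraph.src_surjective v
  exact (G.next_corner d).imp G.valence_eq_two G.valence_eq_three

end Gluing

/-! ### Connectivity, distances and vertex counts -/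

namespace Fatgraph

variable {k : ℕ} (Y : Fatgraph k)

theorem reachable_src_rev (d : Y.Dart) : Y.graph.Reachable (Y.src d) (Y.src (Y.rev d)) := by
  by_cases h : Y.src d = Y.src (Y.rev d)
  · rw [h]
  · exact SimpleGraph.Adj.reachable ((SimpleGraph.fromRel_adj _ _ _).2 ⟨h, Or.inl ⟨d, rfl, rfl⟩⟩)

theorem src_next (d : Y.Dart) : Y.src (Y.next d) = Y.src d :=
  ((Y.src_eq_iff _ _).2 ⟨1, by simp⟩).symm

theorem reachable_src_face (d : Y.Dart) : Y.graph.Reachable (Y.src d) (Y.src (Y.face d)) := by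
  rw [show Y.face d = Y.next (Y.rev d) from rfl, src_next]
  exact Y.reachable_src_rev d

/-- A height function that changes by at most one along each edge bounds the distance below. -/
theorem le_edist_of_height (p : Y.Vertex → ℤ)
    (hp : ∀ d, |p (Y.src d) - p (Y.src (Y.rev d))| ≤ 1) (u v : Y.Vertex) :
    ((p u - p v).natAbs : ℕ∞) ≤ Y.graph.edist u v := by
  have hadj : ∀ {u v}, Y.graph.Adj u v → |p u - p v| ≤ 1 := by
    intro u v h
    obtain ⟨-, ⟨d, rfl, rfl⟩ | ⟨d, rfl, rfl⟩⟩ := (SimpleGraph.fromRel_adj _ _ _).1 h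
    · exact hp d
    · rw [abs_sub_comm]
      exact hp d
  have hwalk : ∀ {u v} (q : Y.graph.Walk u v), (p u - p v).natAbs ≤ q.length := by
    intro u v q
    induction q with
    | nil => simp
    | cons h q ih =>
      have := abs_le.1 (hadj h)
      rw [SimpleGraph.Walk.length_cons]
      omega
  by_cases htop : Y.graph.edist u v = ⊤
  · rw [htop]
    exact le_top
  · obtain ⟨q, hq⟩ := SimpleGraph.exists_walk_of_edist_ne_top htop
    rw [← hq]
    exact_mod_cast hwalk q

/-- The number of vertices, as a sum over the darts. -/
theorem card_vertex_eq_sum [Fintype Y.Dart] :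
    (Nat.card Y.Vertex : ℚ) = ∑ d : Y.Dart, (1 : ℚ) / Y.valence (Y.src d) := by
  classical
  have := Y.finVertex
  have := Fintype.ofFinite Y.Vertex
  rw [← Finset.sum_fiberwise (s := Finset.univ) (g := Y.src), Nat.card_eq_fintype_card,
    ← Finset.card_univ, Finset.cast_card]
  refine Finset.sum_congr rfl fun v _ => ?_
  have h1 : (Finset.univ.filter fun d => Y.src d = v).card = Y.valence v := by
    rw [valence, Nat.card_eq_fintype_card, Fintype.card_subtype]
  rw [Finset.sum_congr rfl (g := fun _ => (1 : ℚ) / Y.valence v) (by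
    intro d hd
    rw [(Finset.mem_filter.1 hd).2]), Finset.sum_const, h1, nsmul_eq_mul]
  have h2 : (Y.valence v : ℚ) ≠ 0 := by
    rw [← h1, Nat.cast_ne_zero, Finset.card_ne_zero]
    obtain ⟨d, hd⟩ := Y.src_surjective v
    exact ⟨d, by simpa using hd⟩
  field_simp

end Fatgraph

section Letters

variable {k L : ℕ} [NeZero L]

theorem val_neg_one_sub (i : ZMod L) : (-1 - i).val = L - 1 - i.val := by
  have hi := ZMod.val_lt i
  have h : (-1 - i : ZMod L) = ((L - 1 - i.val : ℕ) : ZMod L) := by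
    rw [Nat.sub_sub, Nat.cast_sub (by omega)]
    push_cast
    rw [ZMod.natCast_self, ZMod.natCast_zmod_val]
    ring
  rw [h, ZMod.val_natCast_of_lt (by omega)]

theorem letterAt_invWord (l : List (Fin k × Bool)) (hl : l.length = L) (i : ZMod L) :
    letterAt (invWord l) (by simpa using hl) (-1 - i) = invLetter (letterAt l hl i) := by
  have hi := ZMod.val_lt i
  simp only [letterAt, invWord, List.getElem_reverse, List.getElem_map, val_neg_one_sub,
    List.length_map, hl]
  congr 2
  omega

end Letters

/-- The numbers of occurrences of the loops in the boundary of a fatgraph. -/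
def Fatgraph.boundaryVec {k : ℕ} (Y : Fatgraph k) (L : ℕ) : Loop k L → ℤ :=
  fun s => Nat.card {b // Y.boundaryWord b = s.1}

theorem isLoop_invWord {k L : ℕ} {l : List (Fin k × Bool)}
    (h : IsLoop L (l : Cycle (Fin k × Bool))) : IsLoop L (invWord l : Cycle (Fin k × Bool)) :=
  (Loop.inv ⟨_, h⟩).2

/-! ### Boundary vectors of gluings, and circles as good annuli -/

namespace Gluing

variable {k L : ℕ} [NeZero L] (G : Gluing k L)

/-- The loop along the boundary of a polygon. -/
def loop (f : G.Face) : Loop k L := ⟨(G.word f : Cycle (Fin k × Bool)), G.isLoop f⟩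

open Classical in
theorem boundaryVec_eq [Fintype G.Face] :
    G.toFatgraph.boundaryVec L = ∑ f, Pi.single (G.loop f) (1 : ℤ) := by
  funext s
  rw [Fatgraph.boundaryVec, card_boundaryWord_eq, Finset.sum_apply, Nat.card_eq_fintype_card,
    Fintype.card_subtype, Finset.card_eq_sum_ones, Finset.sum_filter]
  push_cast
  refine Finset.sum_congr rfl fun f _ => ?_
  rw [Pi.single_apply]
  refine if_congr ?_ rfl rfl
  exact (Subtype.ext_iff (a1 := G.loop f) (a2 := s)).symm.trans eq_comm

theorem reachable_face (f : G.Face) (i : ZMod L) :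
    G.toFatgraph.graph.Reachable (G.toFatgraph.src (f, 0)) (G.toFatgraph.src (f, i)) := by
  have h : ∀ n : ℕ,
      G.toFatgraph.graph.Reachable (G.toFatgraph.src (f, 0)) (G.toFatgraph.src (f, (n : ZMod L))) := by
    intro n
    induction n with
    | zero => rw [Nat.cast_zero]
    | succ n ih =>
      refine ih.trans ?_
      have h1 := G.toFatgraph.reachable_src_face (f, (n : ZMod L))
      have h2 : G.toFatgraph.face (f, (n : ZMod L)) = (f, ((n + 1 : ℕ) : ZMod L)) := by
        refine (congrArg (fun p : Equiv.Perm (G.Face × ZMod L) => p (f, (n : ZMod L)))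
          G.face_toFatgraph).trans ?_
        simp [faceStep_apply]
      rwa [h2] at h1
  simpa using h i.val

/-- The boundary of each polygon is connected, so it is enough that all polygons share their initial
corner. -/
theorem connected [Nonempty G.Face]
    (h : ∀ f g, G.toFatgraph.src (f, 0) = G.toFatgraph.src (g, 0)) :
    G.toFatgraph.graph.Connected := by
  obtain ⟨f₀⟩ := ‹Nonempty G.Face›
  have : Nonempty G.toFatgraph.Vertex := ⟨G.toFatgraph.src (f₀, 0)⟩
  refine SimpleGraph.Connected.mk fun u v => ?_
  obtain ⟨⟨f, i⟩, rfl⟩ := G.toFatgraph.src_surjective u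
  obtain ⟨⟨g, j⟩, rfl⟩ := G.toFatgraph.src_surjective v
  refine (G.reachable_face f i).symm.trans ?_
  rw [h f g]
  exact G.reachable_face g j

theorem src_next_eq (d : G.Face × ZMod L) :
    G.toFatgraph.src (G.next d) = G.toFatgraph.src d :=
  G.toFatgraph.src_next d

theorem face_pow_apply (n : ℕ) (d : G.Face × ZMod L) :
    (G.toFatgraph.face ^ n) d = (d.1, d.2 + n) := by
  rw [← Equiv.Perm.iterate_eq_pow]
  exact (congrArg (fun p : Equiv.Perm (G.Face × ZMod L) => p^[n] d)
    G.face_toFatgraph).trans (G.faceStep_iterate n d)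

/-- A circle, whose fattening is an annulus between a loop and its inverse. -/
def circle (l : List (Fin k × Bool)) (hl : IsLoop L (l : Cycle (Fin k × Bool))) : Gluing k L where
  Face := Bool
  finFace := inferInstance
  word := fun b => if b then l else invWord l
  isLoop := by
    rintro (- | -)
    · exact isLoop_invWord hl
    · exact hl
  length_word := by
    have := (isLoop_coe.1 hl).1
    rintro (- | -) <;> simpa
  -- Side `i` of a word matches side `L - 1 - i` of its inverse.
  rev := fun d => (!d.1, -1 - d.2)
  rev_rev := by
    rintro ⟨b, i⟩
    simp
  rev_ne := by
    rintro ⟨b, i⟩ h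
    simpa using congrArg Prod.fst h
  letterAt_rev := by
    have hlen := (isLoop_coe.1 hl).1
    rintro ⟨- | -, i⟩
    · have h := letterAt_invWord l hlen (-1 - i)
      rw [sub_sub_cancel] at h
      exact (invLetter_invLetter _).symm.trans (congrArg invLetter h.symm)
    · exact letterAt_invWord l hlen i
  corner := by
    rintro ⟨b, i⟩
    left
    simp
    ring

section Circle

variable (l : List (Fin k × Bool)) (hl : IsLoop L (l : Cycle (Fin k × Bool)))

theorem next_circle (b : Bool) (i : ZMod L) : (circle l hl).next (b, i) = (!b, -i) := by
  rw [next_apply]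
  change (!b, -1 - i + 1) = _
  congr 1
  ring

theorem valence_circle (v) : (circle l hl).toFatgraph.valence v = 2 := by
  obtain ⟨⟨b, i⟩, rfl⟩ := (circle l hl).toFatgraph.src_surjective v
  apply valence_eq_two
  refine (congrArg (circle l hl).next (next_circle l hl b i)).trans ?_
  refine (next_circle l hl (!b) (-i)).trans ?_
  exact Prod.ext (Bool.not_not b) (neg_neg i)

theorem isGoodAnnulus_circle : (circle l hl).toFatgraph.IsGoodAnnulus L := by
  refine ⟨?_, ?_, ?_, (circle l hl).hasBoundaryIn⟩
  · have : Nonempty (circle l hl).Face := ⟨true⟩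
    apply connected
    have h : ∀ b, (circle l hl).toFatgraph.src ((!b, 0) : Bool × ZMod L) =
        (circle l hl).toFatgraph.src ((b, 0) : Bool × ZMod L) := by
      intro b
      have h1 := next_circle l hl b 0
      rw [neg_zero] at h1
      exact (congrArg (circle l hl).toFatgraph.src h1).symm.trans
        ((circle l hl).src_next_eq (b, 0))
    rintro (- | -) (- | -)
    · rfl
    · exact h true
    · exact h false
    · rfl
  · let : Fintype (circle l hl).toFatgraph.Dart := inferInstanceAs (Fintype (Bool × ZMod L))
    have hd : Nat.card (circle l hl).toFatgraph.Dart = 2 * L := by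
      change Nat.card (Bool × ZMod L) = _
      simp
    have h := (circle l hl).toFatgraph.card_vertex_eq_sum
    simp only [valence_circle, Finset.sum_const, Finset.card_univ, ← Nat.card_eq_fintype_card, hd,
      nsmul_eq_mul] at h
    have h' : Nat.card (circle l hl).toFatgraph.Vertex = L := by
      have : (Nat.card (circle l hl).toFatgraph.Vertex : ℚ) = (L : ℚ) := by
        rw [h]
        push_cast
        ring
      exact_mod_cast this
    rw [Fatgraph.eulerChar, hd, h']
    push_cast
    omega
  · rw [card_boundary]
    change Nat.card Bool = 2
    simp

theorem isThin_circle : (circle l hl).toFatgraph.IsThin L := by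
  refine ⟨(circle l hl).hasBoundaryIn, (circle l hl).isTrivalent, fun u v hu => ?_⟩
  rw [valence_circle] at hu
  omega

open Classical in
theorem boundaryVec_circle : (circle l hl).toFatgraph.boundaryVec L =
    Pi.single ⟨_, hl⟩ 1 + Pi.single (Loop.inv ⟨_, hl⟩) 1 := by
  let : Fintype (circle l hl).Face := inferInstanceAs (Fintype Bool)
  rw [boundaryVec_eq]
  exact Fintype.sum_bool _

end Circle

end Gluing

/-! ### Theta graphs as good pairs of pants -/

namespace Gluing

section Theta

variable {k n : ℕ}

/-- The pairing of the sides of three polygons with `2 (n + 1)` sides each that glues them to the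
fattening of a theta graph. -/
def thetaRev (n : ℕ) (d : ZMod 3 × ZMod (2 * (n + 1))) : ZMod 3 × ZMod (2 * (n + 1)) :=
  (if d.2.val < n + 1 then d.1 - 1 else d.1 + 1, -1 - d.2)

/-- The rotation about the vertices in the fattening of a theta graph. -/
def thetaNext (n : ℕ) (d : ZMod 3 × ZMod (2 * (n + 1))) : ZMod 3 × ZMod (2 * (n + 1)) :=
  (if d.2.val < n + 1 then d.1 - 1 else d.1 + 1, -d.2)

theorem thetaRev_thetaRev (d : ZMod 3 × ZMod (2 * (n + 1))) : thetaRev n (thetaRev n d) = d := by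
  obtain ⟨e, i⟩ := d
  have hi := ZMod.val_lt i
  simp only [thetaRev, val_neg_one_sub, sub_sub_cancel, Prod.mk.injEq, and_true]
  split_ifs
  · omega
  · ring
  · ring
  · omega

theorem thetaRev_add_one (d : ZMod 3 × ZMod (2 * (n + 1))) :
    ((thetaRev n d).1, (thetaRev n d).2 + 1) = thetaNext n d :=
  Prod.ext rfl (by simp only [thetaRev, thetaNext]; ring)

theorem thetaNext_zero (e : ZMod 3) : thetaNext n (e, 0) = (e - 1, 0) := by
  simp [thetaNext]

theorem val_half : ((n + 1 : ℕ) : ZMod (2 * (n + 1))).val = n + 1 :=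
  ZMod.val_natCast_of_lt (by omega)

theorem neg_half : -((n + 1 : ℕ) : ZMod (2 * (n + 1))) = ((n + 1 : ℕ) : ZMod (2 * (n + 1))) := by
  rw [neg_eq_iff_add_eq_zero, ← Nat.cast_add, ← two_mul, ZMod.natCast_self]

theorem eq_half {i : ZMod (2 * (n + 1))} (h : i.val = n + 1) : i = ((n + 1 : ℕ) : ZMod _) :=
  ZMod.val_injective _ (by rw [h, val_half])

theorem thetaNext_half (e : ZMod 3) :
    thetaNext n (e, ((n + 1 : ℕ) : ZMod _)) = (e + 1, ((n + 1 : ℕ) : ZMod _)) := by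
  simp only [thetaNext, val_half, neg_half, lt_irrefl, if_false]

/-- Away from the corners 0 and `n + 1`, negation exchanges the two halves of a polygon, so the
second shift of faces undoes the first. -/
theorem thetaNext_thetaNext {e : ZMod 3} {i : ZMod (2 * (n + 1))} (h0 : i ≠ 0)
    (h1 : i.val ≠ n + 1) : thetaNext n (thetaNext n (e, i)) = (e, i) := by
  have hi := ZMod.val_lt i
  have hi0 : i.val ≠ 0 := by rwa [Ne, ZMod.val_eq_zero]
  simp only [thetaNext, ZMod.neg_val, h0, if_false, neg_neg, Prod.mk.injEq, and_true]
  split_ifs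
  · omega
  · ring
  · ring
  · omega

theorem thetaNext_cube {e : ZMod 3} {i : ZMod (2 * (n + 1))} (h : i = 0 ∨ i.val = n + 1) :
    thetaNext n (thetaNext n (thetaNext n (e, i))) = (e, i) := by
  rcases h with rfl | h
  · simp only [thetaNext_zero]
    have h3 : ∀ e : ZMod 3, e - 1 - 1 - 1 = e := by decide
    rw [h3]
  · rw [eq_half h]
    simp only [thetaNext_half]
    have h3 : ∀ e : ZMod 3, e + 1 + 1 + 1 = e := by decide
    rw [h3]

variable (a : ZMod 3 → Word k n) (ha : ∀ e, (a e).Compat (a (e + 1)))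

theorem length_append_inv (b c : Word k n) : (b.1 ++ c.inv.1).length = 2 * (n + 1) := by
  rw [List.length_append, b.2.1, c.inv.2.1, two_mul]

theorem letterAt_thetaRev_of_lt {e : ZMod 3} {i : ZMod (2 * (n + 1))} (hi : i.val < n + 1) :
    letterAt ((a (thetaRev n (e, i)).1).1 ++ (a ((thetaRev n (e, i)).1 + 1)).inv.1)
      (length_append_inv _ _) (thetaRev n (e, i)).2 =
      invLetter (letterAt ((a e).1 ++ (a (e + 1)).inv.1) (length_append_inv _ _) i) := by
  have h1 : (thetaRev n (e, i)).1 = e - 1 := if_pos hi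
  have h2 : (thetaRev n (e, i)).2.val = 2 * (n + 1) - 1 - i.val := val_neg_one_sub i
  have hlen : ∀ w : Word k n, w.1.length = n + 1 := fun w => w.2.1
  simp only [letterAt, h2, h1, sub_add_cancel]
  rw [List.getElem_append_right (by rw [hlen]; omega), List.getElem_append_left (by rw [hlen]; omega)]
  simp only [Word.inv, invWord, List.getElem_reverse, List.getElem_map, List.length_map, hlen]
  congr 2
  omega

/-- A theta graph, whose fattening is a pair of pants. -/
def theta : Gluing k (2 * (n + 1)) where
  Face := ZMod 3
  finFace := inferInstance
  word := fun e => (a e).1 ++ (a (e + 1)).inv.1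
  isLoop := fun e => Word.isLoop_append_inv (ha e)
  length_word := fun e => length_append_inv _ _
  -- The word `a e` is the first half of face `e` and, inverted, the second half of face `e - 1`.
  rev := thetaRev n
  rev_rev := thetaRev_thetaRev
  rev_ne := by
    rintro ⟨e, i⟩ h
    have h1 := congrArg Prod.fst h
    simp only [thetaRev] at h1
    have h2 : ∀ e : ZMod 3, e - 1 ≠ e ∧ e + 1 ≠ e := by decide
    split_ifs at h1
    · exact (h2 e).1 h1
    · exact (h2 e).2 h1
  letterAt_rev := by
    rintro ⟨e, i⟩
    by_cases hi : i.val < n + 1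
    · exact letterAt_thetaRev_of_lt a hi
    · have h := letterAt_thetaRev_of_lt a (e := (thetaRev n (e, i)).1) (i := (thetaRev n (e, i)).2)
        (by
          have h2 : (thetaRev n (e, i)).2.val = 2 * (n + 1) - 1 - i.val := val_neg_one_sub i
          have := ZMod.val_lt i
          omega)
      simp only [Prod.mk.eta, thetaRev_thetaRev] at h
      exact (invLetter_invLetter _).symm.trans (congrArg invLetter h.symm)
  corner := by
    rintro ⟨e, i⟩
    have hf : (fun d : ZMod 3 × ZMod (2 * (n + 1)) => ((thetaRev n d).1, (thetaRev n d).2 + 1)) =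
        thetaNext n := funext thetaRev_add_one
    rw [hf]
    by_cases h : i = 0 ∨ i.val = n + 1
    · exact Or.inr (thetaNext_cube h)
    · rw [not_or] at h
      exact Or.inl (thetaNext_thetaNext h.1 h.2)

theorem next_theta (d : ZMod 3 × ZMod (2 * (n + 1))) : (theta a ha).next d = thetaNext n d :=
  thetaRev_add_one d

theorem next_theta_fun : ((theta a ha).next : _ → _) = thetaNext n :=
  funext fun d => next_theta a ha d

theorem valence_theta (e : ZMod 3) (i : ZMod (2 * (n + 1))) :
    (theta a ha).toFatgraph.valence ((theta a ha).toFatgraph.src (e, i)) =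
      if i = 0 ∨ i.val = n + 1 then 3 else 2 := by
  split_ifs with h
  · apply valence_eq_three
    rw [next_theta_fun]
    exact thetaNext_cube h
  · apply valence_eq_two
    rw [next_theta_fun]
    rw [not_or] at h
    exact thetaNext_thetaNext h.1 h.2

theorem valence_theta_eq_three_iff {e : ZMod 3} {i : ZMod (2 * (n + 1))} :
    (theta a ha).toFatgraph.valence ((theta a ha).toFatgraph.src (e, i)) = 3 ↔
      i = 0 ∨ i.val = n + 1 := by
  rw [valence_theta]
  split_ifs with h <;> simp [h]

theorem valence_theta_eq_two_iff {e : ZMod 3} {i : ZMod (2 * (n + 1))} :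
    (theta a ha).toFatgraph.valence ((theta a ha).toFatgraph.src (e, i)) = 2 ↔
      ¬(i = 0 ∨ i.val = n + 1) := by
  rw [valence_theta]
  split_ifs with h <;> simp [h]

theorem src_theta_zero (e f : ZMod 3) :
    (theta a ha).toFatgraph.src (e, 0) = (theta a ha).toFatgraph.src (f, 0) := by
  have h : ∀ e : ZMod 3, (theta a ha).toFatgraph.src (e - 1, 0) =
      (theta a ha).toFatgraph.src (e, 0) := fun e =>
    (congrArg (theta a ha).toFatgraph.src
      ((next_theta a ha (e, 0)).trans (thetaNext_zero e))).symm.trans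
        ((theta a ha).src_next_eq (e, 0))
  have h3 : f = e ∨ f = e - 1 ∨ f = e - 1 - 1 := by
    revert e f
    decide
  rcases h3 with rfl | rfl | rfl
  · rfl
  · exact (h _).symm
  · exact ((h _).trans (h _)).symm

theorem src_theta_half (e f : ZMod 3) :
    (theta a ha).toFatgraph.src (e, ((n + 1 : ℕ) : ZMod (2 * (n + 1)))) =
      (theta a ha).toFatgraph.src (f, ((n + 1 : ℕ) : ZMod (2 * (n + 1)))) := by
  have h : ∀ e : ZMod 3, (theta a ha).toFatgraph.src (e + 1, ((n + 1 : ℕ) : ZMod (2 * (n + 1)))) =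
      (theta a ha).toFatgraph.src (e, ((n + 1 : ℕ) : ZMod (2 * (n + 1)))) := fun e =>
    (congrArg (theta a ha).toFatgraph.src
      ((next_theta a ha (e, _)).trans (thetaNext_half e))).symm.trans
        ((theta a ha).src_next_eq (e, _))
  have h3 : f = e ∨ f = e + 1 ∨ f = e + 1 + 1 := by
    revert e f
    decide
  rcases h3 with rfl | rfl | rfl
  · rfl
  · exact (h _).symm
  · exact ((h _).trans (h _)).symm

theorem edgesHaveLength_theta : (theta a ha).toFatgraph.EdgesHaveLength (n + 1) := by
  rintro ⟨e, i⟩ h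
  have h0 := (valence_theta_eq_three_iff a ha).1 h
  constructor
  · rw [face_pow_apply]
    refine (valence_theta_eq_three_iff a ha).2 ?_
    rcases h0 with rfl | h0
    · right
      rw [zero_add, val_half]
    · left
      change i + _ = 0
      rw [eq_half h0, ← Nat.cast_add, ← two_mul, ZMod.natCast_self]
  · intro j hj0 hj
    rw [face_pow_apply]
    refine (valence_theta_eq_two_iff a ha).2 ?_
    have hv : (i + (j : ZMod (2 * (n + 1)))).val = i.val + j := by
      have hij : i.val + j < 2 * (n + 1) := by
        rcases h0 with rfl | h0
        · rw [ZMod.val_zero]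
          omega
        · omega
      rw [ZMod.val_add_of_lt] <;> rw [ZMod.val_natCast_of_lt (by omega)]
      exact hij
    rw [← ZMod.val_eq_zero, hv]
    rcases h0 with rfl | h0
    · rw [ZMod.val_zero]
      omega
    · omega

theorem eulerChar_theta : (theta a ha).toFatgraph.eulerChar = -1 := by
  let : Fintype (theta a ha).toFatgraph.Dart :=
    inferInstanceAs (Fintype (ZMod 3 × ZMod (2 * (n + 1))))
  have hd : Nat.card (theta a ha).toFatgraph.Dart = 3 * (2 * (n + 1)) := by
    change Nat.card (ZMod 3 × ZMod (2 * (n + 1))) = _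
    simp
  have hne : (0 : ZMod (2 * (n + 1))) ≠ ((n + 1 : ℕ) : ZMod _) := by
    intro h
    have := congrArg ZMod.val h
    rw [val_half, ZMod.val_zero] at this
    omega
  -- The weight 1/valence is 1/2, lowered by 1/6 to 1/3 at the six trivalent corners. The sum is `3
  -- (n + 1) - 1`, one less than the number of edges.
  have h : (Nat.card (theta a ha).toFatgraph.Vertex : ℚ) =
      ∑ d : ZMod 3 × ZMod (2 * (n + 1)),
        (1 / 2 - (if d.2 = 0 then 1 / 6 else 0) -
          (if d.2 = ((n + 1 : ℕ) : ZMod (2 * (n + 1))) then 1 / 6 else 0)) := by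
    refine (theta a ha).toFatgraph.card_vertex_eq_sum.trans (Finset.sum_congr rfl ?_)
    rintro ⟨e, i⟩ -
    refine (congrArg (fun t : ℕ => (1 : ℚ) / t) (valence_theta a ha e i)).trans ?_
    by_cases h0 : i = 0
    · subst h0
      simp only [true_or, if_true, if_neg hne]
      norm_num
    · by_cases h1 : i = ((n + 1 : ℕ) : ZMod _)
      · subst h1
        simp only [val_half, or_true, if_true, if_neg h0]
        norm_num
      · have h2 : i.val ≠ n + 1 := fun h => h1 (eq_half h)
        simp only [h0, h1, h2, or_self, if_false]
        norm_num
  have h' : (Nat.card (theta a ha).toFatgraph.Vertex : ℤ) = 3 * (n + 1) - 1 := by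
    have h3 : (Nat.card (theta a ha).toFatgraph.Vertex : ℚ) = 3 * (n + 1) - 1 := by
      rw [h, Fintype.sum_prod_type]
      simp only [Finset.sum_sub_distrib, Finset.sum_ite_eq', Finset.mem_univ, if_true,
        Finset.sum_const, Finset.card_univ, ZMod.card, nsmul_eq_mul]
      push_cast
      ring
    exact_mod_cast h3
  rw [Fatgraph.eulerChar, hd, h']
  push_cast
  omega

theorem isGoodPants_theta : (theta a ha).toFatgraph.IsGoodPants (2 * (n + 1)) := by
  refine ⟨?_, eulerChar_theta a ha, ?_, (theta a ha).isTrivalent, ?_, (theta a ha).hasBoundaryIn⟩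
  · have : Nonempty (theta a ha).Face := ⟨(0 : ZMod 3)⟩
    exact connected _ (src_theta_zero a ha)
  · rw [card_boundary]
    change Nat.card (ZMod 3) = 3
    simp
  · rw [Nat.mul_div_cancel_left _ two_pos]
    exact edgesHaveLength_theta a ha

/-- The distance to one of the two trivalent vertices of a theta graph. -/
def thetaHeight (n : ℕ) (d : ZMod 3 × ZMod (2 * (n + 1))) : ℤ :=
  min d.2.val (2 * (n + 1) - d.2.val)

theorem thetaHeight_next (d : ZMod 3 × ZMod (2 * (n + 1))) :
    thetaHeight n (thetaNext n d) = thetaHeight n d := by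
  have := ZMod.val_lt d.2
  simp only [thetaHeight, thetaNext, ZMod.neg_val]
  split_ifs with h
  · rw [h, ZMod.val_zero]
  · omega

theorem abs_thetaHeight_rev (d : ZMod 3 × ZMod (2 * (n + 1))) :
    |thetaHeight n d - thetaHeight n (thetaRev n d)| ≤ 1 := by
  have := ZMod.val_lt d.2
  simp only [thetaHeight, thetaRev, val_neg_one_sub]
  rw [abs_le]
  omega

theorem isThin_theta : (theta a ha).toFatgraph.IsThin (2 * (n + 1)) := by
  refine ⟨(theta a ha).hasBoundaryIn, (theta a ha).isTrivalent, fun u v hu hv huv => ?_⟩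
  let p : (theta a ha).toFatgraph.Vertex → ℤ := Quotient.lift (thetaHeight n) (by
    intro d e hde
    have hde' : (theta a ha).next.SameCycle d e := hde
    refine (sameCycle_mem (S := {x | thetaHeight n x = thetaHeight n d}) (fun x => ?_) rfl hde').symm
    have hx : thetaHeight n ((theta a ha).next x) = thetaHeight n x :=
      (congrArg (thetaHeight n) (next_theta a ha x)).trans (thetaHeight_next x)
    exact ⟨hx.trans, hx.symm.trans⟩)
  have h := (theta a ha).toFatgraph.le_edist_of_height p (fun d => abs_thetaHeight_rev d) u v
  -- The two trivalent vertices have heights 0 and `n + 1`, so their distance is at least `L / 2`,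
  -- more than thinness asks.
  have key : (p u - p v).natAbs = n + 1 := by
    obtain ⟨⟨e, i⟩, rfl⟩ := (theta a ha).toFatgraph.src_surjective u
    obtain ⟨⟨f, j⟩, rfl⟩ := (theta a ha).toFatgraph.src_surjective v
    change (thetaHeight n (e, i) - thetaHeight n (f, j)).natAbs = n + 1
    rcases (valence_theta_eq_three_iff a ha).1 hu with hi | hi <;>
      rcases (valence_theta_eq_three_iff a ha).1 hv with hj | hj
    · subst hi hj
      exact absurd (src_theta_zero a ha e f) huv
    · subst hi
      simp only [thetaHeight, hj]
      rw [ZMod.val_zero]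
      omega
    · subst hj
      simp only [thetaHeight, hi]
      rw [ZMod.val_zero]
      omega
    · rw [eq_half hi, eq_half hj] at huv
      exact absurd (src_theta_half a ha e f) huv
  rw [key] at h
  refine le_trans ?_ (mul_le_mul_right h 4)
  norm_cast
  omega

open Classical in
theorem boundaryVec_theta : (theta a ha).toFatgraph.boundaryVec (2 * (n + 1)) =
    ∑ e, Pi.single (ha e).loop 1 := by
  let : Fintype (theta a ha).Face := inferInstanceAs (Fintype (ZMod 3))
  rw [boundaryVec_eq]
  rfl

end Theta

end Gluing

/-! ### Disjoint unions -/

namespace Fatgraph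

variable {k m : ℕ} (P : Fin m → Fatgraph k)

/-- The inclusion of the darts of a component into a disjoint union. -/
def inclDart (i : Fin m) (d : (P i).Dart) : (disjointUnion P).Dart := ⟨i, d⟩

theorem inclDart_inj {i : Fin m} {d e : (P i).Dart} : inclDart P i d = inclDart P i e ↔ d = e :=
  ⟨fun h => eq_of_heq (Sigma.mk.inj h).2, fun h => by rw [h]⟩

theorem face_inclDart (i : Fin m) (d : (P i).Dart) :
    (disjointUnion P).face (inclDart P i d) = inclDart P i ((P i).face d) := rfl

theorem face_disjointUnion_iterate (j : ℕ) (i : Fin m) (d : (P i).Dart) :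
    (disjointUnion P).face^[j] (inclDart P i d) = inclDart P i ((P i).face^[j] d) := by
  induction j with
  | zero => rfl
  | succ j ih => rw [Function.iterate_succ_apply', Function.iterate_succ_apply', ih, face_inclDart]

theorem eq_of_sameCycle_face {i j : Fin m} {d : (P i).Dart} {e : (P j).Dart}
    (h : (disjointUnion P).face.SameCycle (inclDart P i d) (inclDart P j e)) : i = j := by
  have := (disjointUnion P).finDart
  obtain ⟨n, hn⟩ := h.exists_nat_pow_eq
  rw [← Equiv.Perm.iterate_eq_pow, face_disjointUnion_iterate] at hn
  exact congrArg Sigma.fst hn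

theorem sameCycle_face_inclDart {i : Fin m} {d e : (P i).Dart} :
    (disjointUnion P).face.SameCycle (inclDart P i d) (inclDart P i e) ↔
      (P i).face.SameCycle d e := by
  have := (disjointUnion P).finDart
  have := (P i).finDart
  constructor
  · intro h
    obtain ⟨n, hn⟩ := h.exists_nat_pow_eq
    rw [← Equiv.Perm.iterate_eq_pow, face_disjointUnion_iterate, inclDart_inj] at hn
    refine ⟨n, ?_⟩
    rw [zpow_natCast, ← Equiv.Perm.iterate_eq_pow, hn]
  · intro h
    obtain ⟨n, hn⟩ := h.exists_nat_pow_eq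
    refine ⟨n, ?_⟩
    rw [zpow_natCast, ← Equiv.Perm.iterate_eq_pow, face_disjointUnion_iterate,
      Equiv.Perm.iterate_eq_pow, hn]

/-- The boundary components of a disjoint union. -/
def boundaryDisjointUnionEquiv : (Σ i, (P i).Boundary) ≃ (disjointUnion P).Boundary :=
  Equiv.ofBijective
    (fun x => Quotient.lift
      (fun d => (Quotient.mk _ (inclDart P x.1 d) : (disjointUnion P).Boundary))
      (fun _ _ h => Quotient.sound ((sameCycle_face_inclDart P).2 h)) x.2) (by
    constructor
    · rintro ⟨i, b⟩ ⟨j, c⟩ h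
      induction b using Quotient.inductionOn with
      | h d =>
      induction c using Quotient.inductionOn with
      | h e =>
      have h' : (disjointUnion P).face.SameCycle (inclDart P i d) (inclDart P j e) :=
        Quotient.exact h
      obtain rfl := eq_of_sameCycle_face P h'
      exact congrArg (Sigma.mk i) (Quotient.sound ((sameCycle_face_inclDart P).1 h'))
    · intro b
      induction b using Quotient.inductionOn with
      | h d => exact ⟨⟨d.1, Quotient.mk _ d.2⟩, rfl⟩)

theorem boundaryWord_disjointUnion (x : Σ i, (P i).Boundary) :
    (disjointUnion P).boundaryWord (boundaryDisjointUnionEquiv P x) =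
      (P x.1).boundaryWord x.2 := by
  obtain ⟨i, b⟩ := x
  induction b using Quotient.inductionOn with
  | h d =>
  change (Function.periodicOrbit (disjointUnion P).face (inclDart P i d)).map (disjointUnion P).label =
    (Function.periodicOrbit (P i).face d).map (P i).label
  have hper : Function.minimalPeriod (disjointUnion P).face (inclDart P i d) =
      Function.minimalPeriod (P i).face d := by
    refine Function.minimalPeriod_eq_minimalPeriod_iff.2 fun n => ?_
    rw [Function.IsPeriodicPt, Function.IsFixedPt, face_disjointUnion_iterate,
      Function.IsPeriodicPt, Function.IsFixedPt, inclDart_inj]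
  rw [Function.periodicOrbit_def, Function.periodicOrbit_def, hper, Cycle.map_coe, Cycle.map_coe,
    List.map_map, List.map_map]
  congr 1
  refine List.map_congr_left fun n _ => ?_
  rw [Function.comp_apply, face_disjointUnion_iterate]
  rfl

theorem boundaryVec_disjointUnion (L : ℕ) :
    (disjointUnion P).boundaryVec L = ∑ i, (P i).boundaryVec L := by
  funext s
  rw [Finset.sum_apply]
  have h1 : ∀ i, Finite (P i).Boundary := fun i => by
    have := (P i).finDart
    exact Quotient.finite _
  have e : {b // (disjointUnion P).boundaryWord b = s.1} ≃
      Σ i, {b // (P i).boundaryWord b = s.1} :=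
    ((boundaryDisjointUnionEquiv P).subtypeEquiv
      (p := fun x => (P x.1).boundaryWord x.2 = s.1)
      fun x => by rw [boundaryWord_disjointUnion]).symm.trans
    { toFun := fun x => ⟨x.1.1, x.1.2, x.2⟩
      invFun := fun x => ⟨⟨x.1, x.2.1⟩, x.2.2⟩
      left_inv := fun _ => rfl
      right_inv := fun _ => rfl }
  simp only [boundaryVec]
  rw [Nat.card_congr e, Nat.card_sigma]
  push_cast
  rfl

theorem valence_disjointUnion (i : Fin m) (v : (P i).Vertex) :
    (disjointUnion P).valence ⟨i, v⟩ = (P i).valence v := by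
  refine (Nat.card_congr (Equiv.ofBijective
    (fun d : {d : (P i).Dart // (P i).src d = v} =>
      (⟨⟨i, d.1⟩, congrArg (Sigma.mk i) d.2⟩ :
        {d : (disjointUnion P).Dart // (disjointUnion P).src d = ⟨i, v⟩})) ⟨?_, ?_⟩)).symm
  · rintro ⟨d, hd⟩ ⟨e, he⟩ h
    exact Subtype.ext (eq_of_heq (Sigma.mk.inj (congrArg Subtype.val h)).2)
  · rintro ⟨⟨j, d⟩, hd⟩
    obtain rfl : j = i := congrArg Sigma.fst hd
    exact ⟨⟨d, eq_of_heq (Sigma.mk.inj hd).2⟩, rfl⟩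

theorem adj_disjointUnion {i : Fin m} {u : (P i).Vertex} {y : (disjointUnion P).Vertex}
    (h : (disjointUnion P).graph.Adj ⟨i, u⟩ y) :
    ∃ v, y = ⟨i, v⟩ ∧ (P i).graph.Adj u v := by
  obtain ⟨hne, ⟨⟨j, d⟩, h1, rfl⟩ | ⟨⟨j, d⟩, rfl, h1⟩⟩ := (SimpleGraph.fromRel_adj _ _ _).1 h
  · obtain rfl : j = i := congrArg Sigma.fst h1
    have h2 : (P j).src d = u := eq_of_heq (Sigma.mk.inj h1).2
    refine ⟨_, rfl, (SimpleGraph.fromRel_adj _ _ _).2 ⟨?_, Or.inl ⟨d, h2, rfl⟩⟩⟩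
    rintro h3
    exact hne (congrArg (Sigma.mk j) h3)
  · obtain rfl : j = i := congrArg Sigma.fst h1
    have h2 : (P j).src ((P j).rev d) = u := eq_of_heq (Sigma.mk.inj h1).2
    refine ⟨_, rfl, (SimpleGraph.fromRel_adj _ _ _).2 ⟨?_, Or.inr ⟨d, rfl, h2⟩⟩⟩
    rintro h3
    exact hne (congrArg (Sigma.mk j) h3)

theorem exists_walk_of_disjointUnion {x y : (disjointUnion P).Vertex}
    (q : (disjointUnion P).graph.Walk x y) :
    ∀ (i : Fin m) (u : (P i).Vertex), x = ⟨i, u⟩ →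
      ∃ v, y = ⟨i, v⟩ ∧ ∃ q' : (P i).graph.Walk u v, q'.length = q.length := by
  induction q with
  | nil => exact fun i u h => ⟨u, h, .nil, rfl⟩
  | cons hadj q ih =>
    rintro i u rfl
    obtain ⟨w, rfl, hw⟩ := adj_disjointUnion P hadj
    obtain ⟨v, rfl, q', hq'⟩ := ih i w rfl
    exact ⟨v, rfl, .cons hw q', congrArg (· + 1) hq'⟩

theorem isThin_disjointUnion {L : ℕ} (hP : ∀ i, (P i).IsThin L) :
    (disjointUnion P).IsThin L := by
  refine ⟨fun b => ?_, ?_, ?_⟩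
  · obtain ⟨x, rfl⟩ := (boundaryDisjointUnionEquiv P).surjective b
    rw [boundaryWord_disjointUnion]
    exact (hP x.1).1 x.2
  · rintro ⟨i, v⟩
    rw [valence_disjointUnion]
    exact (hP i).2.1 v
  · rintro ⟨i, u⟩ y hu hy huy
    -- Vertices in different components fall under infinite distance; otherwise a shortest walk
    -- stays in one component.
    by_cases htop : (disjointUnion P).graph.edist ⟨i, u⟩ y = ⊤
    · rw [htop, ENat.mul_top (by norm_num)]
      exact le_top
    · obtain ⟨q, hq⟩ := SimpleGraph.exists_walk_of_edist_ne_top htop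
      obtain ⟨v, rfl, q', hq'⟩ := exists_walk_of_disjointUnion P q i u rfl
      rw [valence_disjointUnion] at hu hy
      refine ((hP i).2.2 u v hu hy fun h => huy (by rw [h])).trans ?_
      rw [← hq, ← hq']
      exact mul_le_mul_right q'.edist_le 4

end Fatgraph

/-- The integral vectors that bound a disjoint union of thin good pairs of pants and good annuli. -/
def goodMonoid (k L : ℕ) : AddSubmonoid (Loop k L → ℤ) :=
  AddSubmonoid.closure {r | ∃ Y : Fatgraph k,
    (Y.IsGoodPants L ∨ Y.IsGoodAnnulus L) ∧ Y.IsThin L ∧ Y.boundaryVec L = r}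

/-- Boundary vectors add under disjoint union, and thinness passes from the generators to the union.
-/
theorem exists_disjointUnion_of_mem_goodMonoid {k L : ℕ} {v : Loop k L → ℤ}
    (hv : v ∈ goodMonoid k L) : ∃ (m : ℕ) (P : Fin m → Fatgraph k),
      (∀ i, (P i).IsGoodPants L ∨ (P i).IsGoodAnnulus L) ∧
        (Fatgraph.disjointUnion P).IsThin L ∧ (Fatgraph.disjointUnion P).boundaryVec L = v := by
  obtain ⟨l, hl, rfl⟩ := AddSubmonoid.exists_list_of_mem_closure hv
  choose Y hgood hthin hvec using fun i : Fin l.length => hl (l.get i) (List.get_mem l i)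
  refine ⟨l.length, Y, hgood, Fatgraph.isThin_disjointUnion Y hthin, ?_⟩
  rw [Fatgraph.boundaryVec_disjointUnion]
  simp only [hvec]
  rw [← List.sum_ofFn, List.ofFn_get]

theorem Fatgraph.IsThin.bounds {k L : ℕ} {Y : Fatgraph k} (hY : Y.IsThin L)
    {w : Loop k L → ℚ} (hw : ∀ s, (Y.boundaryVec L s : ℚ) = w s) : Y.Bounds w :=
  ⟨hY.1, fun s => by rw [← hw s]; simp [boundaryVec]⟩

/-! ### Inverting generators modulo the uniform vector -/

section

variable {k n : ℕ}

open Classical in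
theorem single_add_single_inv_mem_goodMonoid {L : ℕ} [NeZero L] (s : Loop k L) :
    Pi.single s (1 : ℤ) + Pi.single s.inv 1 ∈ goodMonoid k L := by
  obtain ⟨c, hc⟩ := s
  induction c using Quotient.inductionOn' with
  | h l =>
    exact AddSubmonoid.subset_closure ⟨_, Or.inr (Gluing.isGoodAnnulus_circle l hc),
      Gluing.isThin_circle l hc, Gluing.boundaryVec_circle l hc⟩

open Classical in
theorem single_add_single_add_single_mem_goodMonoid {a b c : Word k n} (hab : a.Compat b)
    (hbc : b.Compat c) (hca : c.Compat a) :
    Pi.single hab.loop (1 : ℤ) + Pi.single hbc.loop 1 + Pi.single hca.loop 1 ∈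
      goodMonoid k (2 * (n + 1)) := by
  let w : ZMod 3 → Word k n := fun e : Fin 3 => ![a, b, c] e
  have hw : ∀ e, (w e).Compat (w (e + 1)) := by
    intro (e : Fin 3)
    match e with
    | 0 => exact hab
    | 1 => exact hbc
    | 2 => exact hca
  refine AddSubmonoid.subset_closure ⟨_, Or.inl (Gluing.isGoodPants_theta w hw),
      Gluing.isThin_theta w hw, ?_⟩
  rw [Gluing.boundaryVec_theta]
  exact Fin.sum_univ_three (fun e : Fin 3 => (Pi.single (hw e).loop (1 : ℤ) :
    Loop k (2 * (n + 1)) → ℤ))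

theorem const_two_eq_sum {L : ℕ} [DecidableEq (Loop k L)] :
    (fun _ : Loop k L => (2 : ℤ)) = ∑ s, (Pi.single s (1 : ℤ) + Pi.single s.inv 1) := by
  rw [Finset.sum_add_distrib]
  have h : ∑ s : Loop k L, Pi.single (M := fun _ => ℤ) s.inv 1 = ∑ s : Loop k L, Pi.single s 1 :=
    Fintype.sum_bijective (Loop.inv (k := k) (L := L))
      (Function.Involutive.bijective Loop.inv_inv) _ _ fun _ => rfl
  rw [h, Finset.univ_sum_single (fun _ : Loop k L => (1 : ℤ))]
  rfl

/-- The integral vectors `x` such that both `x` and `-x` bound good pants and annuli after a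
multiple of the uniform vector is added. -/
def stablyGood (k L : ℕ) : AddSubgroup (Loop k L → ℤ) where
  carrier := {x | (∃ N : ℕ, x + N • (fun _ => 2) ∈ goodMonoid k L) ∧
    ∃ N : ℕ, -x + N • (fun _ => 2) ∈ goodMonoid k L}
  zero_mem' := ⟨⟨0, by simp⟩, ⟨0, by simp⟩⟩
  add_mem' := by
    rintro x y ⟨⟨a, ha⟩, b, hb⟩ ⟨⟨c, hc⟩, d, hd⟩
    refine ⟨⟨a + c, ?_⟩, b + d, ?_⟩
    · convert add_mem ha hc using 1
      rw [add_smul]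
      abel
    · convert add_mem hb hd using 1
      rw [add_smul]
      abel
  neg_mem' := by
    rintro x ⟨h1, h2⟩
    exact ⟨h2, by rwa [neg_neg]⟩

-- The vector 2·1' is the sum of all annuli `t + t⁻¹`; removing the annulus of `s` leaves a sum of
-- annuli.
open Classical in
theorem single_add_single_inv_mem_stablyGood {L : ℕ} [NeZero L] (s : Loop k L) :
    Pi.single s (1 : ℤ) + Pi.single s.inv 1 ∈ stablyGood k L := by
  refine ⟨⟨0, by simpa using single_add_single_inv_mem_goodMonoid s⟩, 1, ?_⟩
  rw [one_smul, const_two_eq_sum, ← Finset.add_sum_erase _ _ (Finset.mem_univ s),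
    neg_add_cancel_left]
  exact sum_mem fun t _ => single_add_single_inv_mem_goodMonoid t

-- Traversing the three words in the opposite order gives pants with the inverse boundary. Together
-- the two pants have the boundary of three annuli, whose negatives are already stably good.
open Classical in
theorem single_add_single_add_single_mem_stablyGood {a b c : Word k n} (hab : a.Compat b)
    (hbc : b.Compat c) (hca : c.Compat a) :
    Pi.single hab.loop (1 : ℤ) + Pi.single hbc.loop 1 + Pi.single hca.loop 1 ∈
      stablyGood k (2 * (n + 1)) := by
  have h := single_add_single_add_single_mem_goodMonoid hab hbc hca
  have h' := single_add_single_add_single_mem_goodMonoid hab.symm hca.symm hbc.symm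
  obtain ⟨N₁, h₁⟩ := (single_add_single_inv_mem_stablyGood hab.loop).2
  obtain ⟨N₂, h₂⟩ := (single_add_single_inv_mem_stablyGood hbc.loop).2
  obtain ⟨N₃, h₃⟩ := (single_add_single_inv_mem_stablyGood hca.loop).2
  refine ⟨⟨0, by simpa using h⟩, N₁ + N₂ + N₃, ?_⟩
  convert add_mem h' (add_mem (add_mem h₁ h₂) h₃) using 1
  rw [add_smul, add_smul, Word.Compat.loop_inv, Word.Compat.loop_inv, Word.Compat.loop_inv]
  abel

/-- Apply the vanishing theorem to the projection onto the quotient by `stablyGood`. No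
torsion-freeness of the quotient is known here, hence the arbitrary coefficient group above. -/
theorem mem_stablyGood (hn : n ≠ 0) {v : Loop k (2 * (n + 1)) → ℤ}
    (hv : homologyMap k _ (fun s => (v s : ℚ)) = 0) : v ∈ stablyGood k (2 * (n + 1)) := by
  classical
  let φ : Loop k (2 * (n + 1)) → (Loop k (2 * (n + 1)) → ℤ) ⧸ stablyGood k (2 * (n + 1)) :=
    fun s => QuotientAddGroup.mk' _ (Pi.single s 1)
  have hφ : IsLoopCocycle φ := by
    constructor
    · intro s
      rw [← map_add]
      exact (QuotientAddGroup.eq_zero_iff _).2 (single_add_single_inv_mem_stablyGood s)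
    · intro a b c hab hbc hca
      rw [← map_add, ← map_add]
      exact (QuotientAddGroup.eq_zero_iff _).2
        (single_add_single_add_single_mem_stablyGood hab hbc hca)
  have h := hφ.sum_eq_zero hn hv
  simp only [φ, ← map_zsmul, ← map_sum] at h
  rw [← (QuotientAddGroup.eq_zero_iff v), ← QuotientAddGroup.mk'_apply, ← h]
  congr 1
  rw [← Finset.univ_sum_single v]
  refine Finset.sum_congr rfl fun s _ => ?_
  rw [← Pi.single_smul]
  simp

end

/-! ### The cone and the neighborhood of the uniform vector -/

section Cone

variable {k L : ℕ}

/-- The rational vectors with a positive multiple in `goodMonoid`. -/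
def goodCone (k L : ℕ) : AddSubmonoid (homTrivial k L) where
  carrier := {v | ∃ c : ℕ, 0 < c ∧ ∃ w ∈ goodMonoid k L, ∀ s, (c : ℚ) * v.1 s = w s}
  zero_mem' := ⟨1, one_pos, 0, zero_mem _, by simp⟩
  add_mem' := by
    rintro x y ⟨c, hc, w, hw, hx⟩ ⟨c', hc', w', hw', hy⟩
    refine ⟨c * c', by positivity, c' • w + c • w', add_mem (nsmul_mem hw _) (nsmul_mem hw' _),
      fun s => ?_⟩
    simp only [Submodule.coe_add, Pi.add_apply, Pi.smul_apply]
    simp only [nsmul_eq_mul]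
    push_cast
    rw [← hx, ← hy]
    ring

theorem smul_mem_goodCone {v : homTrivial k L} (hv : v ∈ goodCone k L) {t : ℚ} (ht : 0 ≤ t) :
    t • v ∈ goodCone k L := by
  obtain ⟨c, hc, w, hw, hx⟩ := hv
  refine ⟨c * t.den, Nat.mul_pos hc t.den_pos, t.num.toNat • w, nsmul_mem hw _, fun s => ?_⟩
  have h1 : ((t.num.toNat : ℤ) : ℚ) = t.num := by
    rw [Int.toNat_of_nonneg (Rat.num_nonneg.2 ht)]
  have h2 : (t.den : ℚ) * t = t.num := by rw [mul_comm, Rat.mul_den_eq_num]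
  simp only [Submodule.coe_smul, Pi.smul_apply, smul_eq_mul, nsmul_eq_mul]
  push_cast at h1 ⊢
  rw [← hx s, h1, ← h2]
  ring

theorem goodCone_subset_thinCone : (goodCone k L : Set (homTrivial k L)) ⊆ thinCone k L := by
  rintro v ⟨c, hc, w, hw, hx⟩
  obtain ⟨m, P, -, hthin, hvec⟩ := exists_disjointUnion_of_mem_goodMonoid hw
  refine ⟨c, by exact_mod_cast hc, _, hthin, hthin.bounds fun s => ?_⟩
  rw [hvec, ← hx]
  rfl

theorem uniform_mem_goodCone [NeZero L] : uniform k L ∈ goodCone k L := by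
  classical
  refine ⟨2, two_pos, fun _ => 2, ?_, fun s => by simp [uniform]⟩
  rw [const_two_eq_sum]
  exact sum_mem fun t _ => single_add_single_inv_mem_goodMonoid t

/-- Clear denominators, apply `mem_stablyGood` and divide again; larger `t` only add a nonnegative
multiple of 1', itself in the cone. -/
theorem exists_add_uniform_mem_goodCone {n : ℕ} (hn : n ≠ 0) (v : homTrivial k (2 * (n + 1))) :
    ∃ N : ℕ, ∀ t : ℚ, N ≤ t → v + t • uniform k (2 * (n + 1)) ∈ goodCone k (2 * (n + 1)) := by
  suffices h : ∃ N : ℕ, v + (N : ℚ) • uniform k (2 * (n + 1)) ∈ goodCone k (2 * (n + 1)) by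
    obtain ⟨N, hN⟩ := h
    refine ⟨N, fun t ht => ?_⟩
    have := add_mem hN (smul_mem_goodCone uniform_mem_goodCone (sub_nonneg.2 ht))
    rwa [add_assoc, ← add_smul, add_sub_cancel] at this
  set D : ℕ := ∏ s, (v.1 s).den with hD
  have hDpos : 0 < D := Finset.prod_pos fun s _ => (v.1 s).den_pos
  have hint : ∀ s, ∃ z : ℤ, (z : ℚ) = D * v.1 s := by
    intro s
    obtain ⟨q, hq⟩ := Finset.dvd_prod_of_mem (fun s => (v.1 s).den) (Finset.mem_univ s)
    refine ⟨q * (v.1 s).num, ?_⟩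
    rw [hD, hq]
    push_cast
    rw [← Rat.mul_den_eq_num (v.1 s)]
    ring
  choose w hw using hint
  have hw0 : homologyMap k _ (fun s => (w s : ℚ)) = 0 := by
    have h1 : (fun s => (w s : ℚ)) = (D : ℚ) • v.1 := funext hw
    rw [h1, map_smul, LinearMap.mem_ker.1 v.2, smul_zero]
  obtain ⟨N, hN⟩ := (mem_stablyGood hn hw0).1
  have hmem : (D : ℚ) • v + (2 * N : ℚ) • uniform k _ ∈ goodCone k (2 * (n + 1)) := by
    refine ⟨1, one_pos, _, hN, fun s => ?_⟩
    simp [uniform, hw]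
    ring
  have h1 := smul_mem_goodCone hmem (t := (D : ℚ)⁻¹) (by positivity)
  have hD0 : (D : ℚ) ≠ 0 := by exact_mod_cast hDpos.ne'
  rw [smul_add, smul_smul, smul_smul, inv_mul_cancel₀ hD0, one_smul] at h1
  obtain ⟨N', hN'⟩ := exists_nat_ge ((D : ℚ)⁻¹ * (2 * N))
  refine ⟨N', ?_⟩
  have := add_mem h1 (smul_mem_goodCone uniform_mem_goodCone (sub_nonneg.2 hN'))
  rwa [add_assoc, ← add_smul, add_sub_cancel] at this

/-- With a projection `π` onto V', the vectors `e s` span V' and `v - r·1' = ∑ (v s - r) • e s`.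
Each term enters the cone at the cost of `|v s - r| * N` copies of 1', and `r` copies are available.
Letting `r` vary makes the neighborhood invariant under scaling. -/
theorem exists_open_subset_goodCone {n : ℕ} (hn : n ≠ 0) :
    ∃ U : Set (homTrivial k (2 * (n + 1))), IsOpen U ∧ uniform k (2 * (n + 1)) ∈ U ∧
      (∀ u ∈ U, ∀ c : ℚ, 0 < c → c • u ∈ U) ∧ U ⊆ goodCone k (2 * (n + 1)) := by
  classical
  obtain ⟨π, hπ⟩ := LinearMap.exists_leftInverse_of_injective (homTrivial k (2 * (n + 1))).subtype
    (Submodule.ker_subtype _)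
  have hπ' : ∀ v : homTrivial k (2 * (n + 1)), π v.1 = v := fun v => LinearMap.congr_fun hπ v
  let e : Loop k (2 * (n + 1)) → homTrivial k (2 * (n + 1)) := fun s => π (Pi.single s 1)
  have hsum : ∀ x : Loop k (2 * (n + 1)) → ℚ, π x = ∑ s, x s • e s := by
    intro x
    conv_lhs => rw [← Finset.univ_sum_single x]
    rw [map_sum]
    refine Finset.sum_congr rfl fun s _ => ?_
    rw [← map_smul, ← Pi.single_smul, smul_eq_mul, mul_one]
  choose N₁ hN₁ using fun s => exists_add_uniform_mem_goodCone hn (e s)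
  choose N₂ hN₂ using fun s => exists_add_uniform_mem_goodCone hn (-e s)
  let N : ℕ := ∑ s, (N₁ s + N₂ s)
  have hle : ∀ s, N₁ s + N₂ s ≤ N := fun s =>
    Finset.single_le_sum (f := fun s => N₁ s + N₂ s) (fun _ _ => Nat.zero_le _) (Finset.mem_univ s)
  have hpos : ∀ s, e s + (N : ℚ) • uniform k _ ∈ goodCone k (2 * (n + 1)) := fun s =>
    hN₁ s N (by exact_mod_cast (Nat.le_add_right _ _).trans (hle s))
  have hneg : ∀ s, -e s + (N : ℚ) • uniform k _ ∈ goodCone k (2 * (n + 1)) := fun s =>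
    hN₂ s N (by exact_mod_cast (Nat.le_add_left _ _).trans (hle s))
  have hboth : ∀ s (τ : ℚ), τ • e s + (|τ| * N) • uniform k _ ∈ goodCone k (2 * (n + 1)) := by
    intro s τ
    rcases le_total 0 τ with h | h
    · rw [abs_of_nonneg h, mul_smul, ← smul_add]
      exact smul_mem_goodCone (hpos s) h
    · have := smul_mem_goodCone (hneg s) (neg_nonneg.2 h)
      rw [abs_of_nonpos h]
      rwa [smul_add, neg_smul_neg, smul_smul] at this
  -- If every `|v s - r|` is below `r / B`, the total cost over all loops is at most `r`; the
  -- summand 1 keeps `B` positive.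
  let B : ℚ := N * Fintype.card (Loop k (2 * (n + 1))) + 1
  have hB : 0 < B := by positivity
  refine ⟨{v | ∃ r : ℚ, 0 < r ∧ ∀ s, |v.1 s - r| * B < r}, ?_, ?_, ?_, ?_⟩
  · have heq : {v : homTrivial k (2 * (n + 1)) | ∃ r : ℚ, 0 < r ∧ ∀ s, |v.1 s - r| * B < r} =
        ⋃ r : ℚ, ⋃ _ : 0 < r, ⋂ s, {v | |v.1 s - r| * B < r} := by
      ext v
      simp
    rw [heq]
    refine isOpen_iUnion fun r => isOpen_iUnion fun _ => isOpen_iInter_of_finite fun s => ?_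
    have hc : Continuous fun v : homTrivial k (2 * (n + 1)) => v.1 s :=
      (continuous_apply s).comp continuous_subtype_val
    exact isOpen_lt ((hc.sub continuous_const).abs.mul continuous_const) continuous_const
  · exact ⟨1, one_pos, fun s => by simp [uniform]⟩
  · rintro u ⟨r, hr, hu⟩ c hc
    refine ⟨c * r, mul_pos hc hr, fun s => ?_⟩
    rw [Submodule.coe_smul, Pi.smul_apply, smul_eq_mul, ← mul_sub, abs_mul, abs_of_pos hc, mul_assoc]
    exact mul_lt_mul_of_pos_left (hu s) hc
  · rintro v ⟨r, hr, hv⟩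
    have hdec : v = ∑ s, ((v.1 s - r) • e s + (|v.1 s - r| * N) • uniform k _) +
        (r - ∑ s, |v.1 s - r| * N) • uniform k _ := by
      have h1 := hsum (v - r • uniform k _ : homTrivial k (2 * (n + 1))).1
      rw [hπ'] at h1
      have h2 : ∀ s, (v - r • uniform k _ : homTrivial k (2 * (n + 1))).1 s = v.1 s - r := by
        intro s
        simp [uniform]
      simp only [h2] at h1
      rw [Finset.sum_add_distrib, ← h1, ← Finset.sum_smul]
      module
    rw [hdec]
    refine add_mem (sum_mem fun s _ => hboth s _) (smul_mem_goodCone uniform_mem_goodCone ?_)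
    have h3 : ∑ s, |v.1 s - r| * N ≤ ∑ _s : Loop k (2 * (n + 1)), r / B * N :=
      Finset.sum_le_sum fun s _ =>
        mul_le_mul_of_nonneg_right ((le_div_iff₀ hB).2 (hv s).le) (Nat.cast_nonneg _)
    have h4 : ∑ _s : Loop k (2 * (n + 1)), r / B * N = r * ((B - 1) / B) := by
      rw [Finset.sum_const, Finset.card_univ, nsmul_eq_mul]
      simp only [B]
      ring
    have h5 : (B - 1) / B ≤ 1 := by
      rw [div_le_one hB]
      linarith
    nlinarith

theorem span_thinCone {n : ℕ} (hn : n ≠ 0) :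
    Submodule.span ℚ (thinCone k (2 * (n + 1))) = ⊤ := by
  refine Submodule.eq_top_iff'.2 fun v => ?_
  obtain ⟨N, hN⟩ := exists_add_uniform_mem_goodCone hn v
  have h1 := Submodule.subset_span (R := ℚ) (goodCone_subset_thinCone (hN N le_rfl))
  have h2 := Submodule.subset_span (R := ℚ)
    (goodCone_subset_thinCone (k := k) (L := 2 * (n + 1)) uniform_mem_goodCone)
  have h3 := sub_mem h1 (Submodule.smul_mem _ (N : ℚ) h2)
  rwa [add_sub_cancel_right] at h3

end Cone

end ThinFatgraph

end

theorem proposition4p1p1 (k L : ℕ) (hL : 0 < L) (h4 : 4 ∣ L) :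
    (∀ v : ThinFatgraph.Loop k L → ℤ,
      (fun s => (v s : ℚ)) ∈ ThinFatgraph.homTrivial k L →
      ∃ (n m : ℕ) (P : Fin m → ThinFatgraph.Fatgraph k),
        (∀ i, (P i).IsGoodPants L ∨ (P i).IsGoodAnnulus L) ∧
        (ThinFatgraph.Fatgraph.disjointUnion P).IsThin L ∧
        (ThinFatgraph.Fatgraph.disjointUnion P).Bounds
          (fun s : ThinFatgraph.Loop k L =>
            (L : ℚ) / 2 * (v s : ℚ) +
              (n : ℚ) * (ThinFatgraph.uniform k L : ThinFatgraph.Loop k L → ℚ) s)) ∧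
    Submodule.span ℚ (ThinFatgraph.thinCone k L) = ⊤ ∧
    ∃ U : Set (ThinFatgraph.homTrivial k L),
      IsOpen U ∧ ThinFatgraph.uniform k L ∈ U ∧
      (∀ u ∈ U, ∀ c : ℚ, 0 < c → c • u ∈ U) ∧
      U ⊆ ThinFatgraph.thinCone k L := by
  -- Half-words have length `n + 1 ≥ 2`, so that their first and last letters occupy different
  -- positions.
  obtain ⟨n, hn, rfl⟩ : ∃ n, n ≠ 0 ∧ L = 2 * (n + 1) := by
    obtain ⟨q, rfl⟩ := h4
    exact ⟨2 * q - 1, by omega, by omega⟩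
  refine ⟨fun v hv => ?_, ThinFatgraph.span_thinCone hn, ?_⟩
  · have hmem := nsmul_mem (ThinFatgraph.mem_stablyGood hn (LinearMap.mem_ker.1 hv)) (n + 1)
    obtain ⟨N, hN⟩ := hmem.1
    obtain ⟨m, P, hgood, hthin, hvec⟩ :=
      ThinFatgraph.exists_disjointUnion_of_mem_goodMonoid hN
    -- The factor 2 appears because `stablyGood` adds multiples of 2·1'.
    refine ⟨2 * N, m, P, hgood, hthin, hthin.bounds fun s => ?_⟩
    rw [hvec]
    simp only [Pi.add_apply, Pi.smul_apply, ThinFatgraph.uniform]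
    simp only [nsmul_eq_mul]
    push_cast
    ring
  · obtain ⟨U, h1, h2, h3, h4⟩ := ThinFatgraph.exists_open_subset_goodCone (k := k) hn
    exact ⟨U, h1, h2, h3, h4.trans ThinFatgraph.goodCone_subset_thinCone⟩
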